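/- **Setting.** Concepts (unary predicates), roles (binary predicates) and individuals are named by elements of countably infinite sets. An *ABox* is a finite set of facts (ground atoms $A(a)$ or $R(a,b)$); a *TBox* is a finite set of DL-Lite$_{\mathcal R}$ axioms. A *conjunctive query* (CQ) is a formula $\exists\vec x\,\gamma$, where $\gamma$ is a non-empty conjunction of function-free atoms and $\vec x\subseteq \mathrm{vars}(\gamma)$; a *Boolean union of CQs* (BUCQ) is a finite disjunction of closed CQs. An *epistemic dependency* (ED) is a sentence $\tau=\forall \vec x_1,\vec x_2\,(K q_b(\vec x_1,\vec x_2)\to K q_h(\vec x_2))$, where $q_b$ is a CQ with free variables $\vec x_1\cup\vec x_2$ and $q_h$ is a CQ with free variables $\vec x_2$ or $\bot$; it is *linear* if $q_b$ has exactly one atom. A first-order theory $\Phi$ *satisfies* $\tau$ if for every substitution $\sigma$ of individuals for the free variables of $q_b$, $\Phi\models\sigma(q_b)$ implies $\Phi\models\sigma(q_h)$. A *policy* is a finite set of EDs, satisfied by $\Phi$ if all its EDs are. A *CQE instance* is a triple $\mathcal E=\langle\mathcal T,\mathcal P,\mathcal A\rangle$ of a TBox, a policy and an ABox with $\mathcal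 T\cup\mathcal A$ consistent. A *GA censor* for $\mathcal E$ is a set $\mathcal C$ of facts entailed by $\mathcal T\cup\mathcal A$ such that $\mathcal T\cup\mathcal C$ satisfies $\mathcal P$; it is *optimal* if it is maximal under inclusion among the GA censors for $\mathcal E$. $\mathcal E$ *IGA-entails* a BUCQ $q$ if $\mathcal T\cup\mathcal C_{\mathsf{IGA}}\models q$, where $\mathcal C_{\mathsf{IGA}}$ is the intersection of all optimal GA censors for $\mathcal E$. **Theorem.** There exist a policy $\mathcal P$ consisting of a single linear ED, and a Boolean query $q$ consisting of a single atom (a closed CQ with exactly one atom), such that the following decision problem is NL-hard under logspace many-one reductions: given an ABox $\mathcal A$, written as a string listing its facts, decide whether the CQE instance $\langle\emptyset,\mathcal P,\mathcal A\rangle$, whose TBox is empty, IGA-entails $q$. In other words, IGA-entailment is NL-hard in data complexity for this fixed policy and this fixed query, even with an empty TBox. -/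

import Mathlib

namespace CQE

/-! ### Atoms, facts, conjunctive queries -/

/-- Names of concepts, roles and individuals: the countably infinite set of strings over `{0,1}`. -/
abbrev Name : Type := List Bool

/-- Variables. -/
abbrev Var : Type := ℕ

/-- Function-free terms: variables or individuals. -/
inductive Term : Type where
  | var (x : Var)
  | const (a : Name)
  deriving DecidableEq

/-- Atoms `A(t)` (with `A` a concept) and `R(t, t')` (with `R` a role), with arguments in `τ`. -/
inductive Atom (τ : Type) : Type where
  | concept (A : Name) (t : τ)
  | role (R : Name) (t t' : τ)
  deriving DecidableEq

/-- Facts are ground atoms. -/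
abbrev Fact : Type := Atom Name

/-- The terms occurring in an atom. -/
def Atom.args {τ : Type} : Atom τ → Set τ
  | .concept _ t => {t}
  | .role _ t t' => {t, t'}

/-- A conjunctive query `∃ x⃗ γ`, where `γ` is the conjunction of the atoms in `atoms` and `x⃗` is the
set `exVars` of variables, all of which occur in `γ`. -/
structure CQ : Type where
  atoms : Finset (Atom Term)
  nonempty : atoms.Nonempty
  exVars : Set Var
  exVars_subset : ∀ x ∈ exVars, ∃ a ∈ atoms, Term.var x ∈ a.args

/-- The variables of a CQ. -/
def CQ.vars (q : CQ) : Set Var := {x | ∃ a ∈ q.atoms, Term.var x ∈ a.args}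

/-- The free variables of a CQ. -/
def CQ.freeVars (q : CQ) : Set Var := q.vars \ q.exVars

/-- A Boolean (closed) CQ. -/
def CQ.IsBoolean (q : CQ) : Prop := q.freeVars = ∅

/-- A Boolean union of conjunctive queries. -/
structure BUCQ : Type where
  disjuncts : Finset CQ
  closed : ∀ q ∈ disjuncts, q.IsBoolean

/-- The query consists of one CQ with only one atom. -/
def BUCQ.IsSingleAtom (q : BUCQ) : Prop := ∃ q₀ : CQ, q.disjuncts = {q₀} ∧ q₀.atoms.card = 1

/-! ### DL-Lite_R ontologies -/

/-- Basic roles `S` and `S⁻`. -/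
inductive BasicRole : Type where
  | pos (S : Name)
  | inv (S : Name)

/-- Basic concepts `A`, `∃S` and `∃S⁻`. -/
inductive BasicConcept : Type where
  | atomic (A : Name)
  | exist (R : BasicRole)

/-- DL-Lite_R axioms `B ⊑ B'`, `R ⊑ R'`, `B ⊑ ¬B'`, `R ⊑ ¬R'`. -/
inductive TAxiom : Type where
  | conceptIncl (B B' : BasicConcept)
  | roleIncl (R R' : BasicRole)
  | conceptDisj (B B' : BasicConcept)
  | roleDisj (R R' : BasicRole)

abbrev TBox : Type := Finset TAxiom

abbrev ABox : Type := Finset Fact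

/-- First-order interpretations over the signature of concepts, roles and individuals. -/
structure Interp : Type 1 where
  Dom : Type
  ind : Name → Dom
  concept : Name → Set Dom
  role : Name → Set (Dom × Dom)

namespace Interp

variable (I : Interp)

def basicRole : BasicRole → Set (I.Dom × I.Dom)
  | .pos S => I.role S
  | .inv S => {p | (p.2, p.1) ∈ I.role S}

def basicConcept : BasicConcept → Set I.Dom
  | .atomic A => I.concept A
  | .exist R => {d | ∃ e, (d, e) ∈ I.basicRole R}

def SatAxiom : TAxiom → Prop
  | .conceptIncl B B' => I.basicConcept B ⊆ I.basicConcept B'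
  | .roleIncl R R' => I.basicRole R ⊆ I.basicRole R'
  | .conceptDisj B B' => Disjoint (I.basicConcept B) (I.basicConcept B')
  | .roleDisj R R' => Disjoint (I.basicRole R) (I.basicRole R')

/-- Truth of an atom when its arguments are evaluated by `v`. -/
def SatAtom {τ : Type} (v : τ → I.Dom) : Atom τ → Prop
  | .concept A t => v t ∈ I.concept A
  | .role R t t' => (v t, v t') ∈ I.role R

/-- Truth of a fact. -/
def SatFact (α : Fact) : Prop := I.SatAtom I.ind α

/-- Value of a term under an assignment of the variables. -/
def termVal (v : Var → I.Dom) : Term → I.Dom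
  | .var x => v x
  | .const a => I.ind a

/-- Truth of a CQ under an assignment `v` (only the values of `v` on the free variables matter). -/
def SatCQ (v : Var → I.Dom) (q : CQ) : Prop :=
  ∃ v' : Var → I.Dom, (∀ x ∉ q.exVars, v' x = v x) ∧ ∀ a ∈ q.atoms, I.SatAtom (I.termVal v') a

/-- `I` is a model of `T ∪ F`, where `F` is a set of facts. -/
def IsModel (T : TBox) (F : Set Fact) : Prop :=
  (∀ φ ∈ T, I.SatAxiom φ) ∧ ∀ α ∈ F, I.SatFact α

end Interp

/-- `T ∪ F` is consistent. -/
def Consistent (T : TBox) (F : Set Fact) : Prop := ∃ I : Interp, I.IsModel T F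

/-- `T ∪ F ⊨ σ(q)` for a CQ `q` and a ground substitution `σ` of its free variables. -/
def EntailsCQ (T : TBox) (F : Set Fact) (σ : Var → Name) (q : CQ) : Prop :=
  ∀ I : Interp, I.IsModel T F → I.SatCQ (fun x => I.ind (σ x)) q

/-- `T ∪ F ⊨ q` for a BUCQ `q`: every model makes some disjunct true (the disjuncts are closed, so
that the assignment plays no role). -/
def EntailsBUCQ (T : TBox) (F : Set Fact) (q : BUCQ) : Prop :=
  ∀ I : Interp, I.IsModel T F → ∃ q' ∈ q.disjuncts, ∃ v : Var → I.Dom, I.SatCQ v q'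

/-- The closure of `F` with respect to `T`: all facts that are logical consequences of `T ∪ F`. -/
def closure (T : TBox) (F : Set Fact) : Set Fact :=
  {α | ∀ I : Interp, I.IsModel T F → I.SatFact α}

/-! ### Epistemic dependencies, censors, IGA-entailment -/

/-- An epistemic dependency `∀ x⃗₁, x⃗₂ (K q_b(x⃗₁, x⃗₂) → K q_h(x⃗₂))`. The head is a CQ whose free
variables are free in the body, or `⊥` (represented by `none`). -/
structure ED : Type where
  body : CQ
  head : Option CQ
  free_subset : ∀ q ∈ head, q.freeVars ⊆ body.freeVars

/-- An ED is linear if its body has exactly one atom. -/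
def ED.IsLinear (τ : ED) : Prop := τ.body.atoms.card = 1

/-- `T ∪ F ⊨ σ(head)`; the head `⊥` is entailed exactly by inconsistent theories. -/
def EntailsHead (T : TBox) (F : Set Fact) (σ : Var → Name) : Option CQ → Prop
  | some q => EntailsCQ T F σ q
  | none => ¬ Consistent T F

/-- `T ∪ F` satisfies the ED `τ`. -/
def SatED (T : TBox) (F : Set Fact) (τ : ED) : Prop :=
  ∀ σ : Var → Name, EntailsCQ T F σ τ.body → EntailsHead T F σ τ.head

/-- A policy is a finite set of EDs. -/
abbrev Policy : Type := Finset ED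

/-- A policy is linear if all its EDs are. -/
def Policy.IsLinear (P : Policy) : Prop := ∀ τ ∈ P, ED.IsLinear τ

/-- CQE instances `⟨T, P, A⟩`. -/
structure Inst : Type where
  tbox : TBox
  policy : Policy
  abox : ABox
  consistent : Consistent tbox (abox : Set Fact)

namespace Inst

variable (E : Inst)

/-- `C` is a GA censor for `E`. -/
def IsCensor (C : Set Fact) : Prop :=
  C ⊆ closure E.tbox (E.abox : Set Fact) ∧ ∀ τ ∈ E.policy, SatED E.tbox C τ

/-- `C` is an optimal GA censor for `E`. -/
def IsOptimalCensor (C : Set Fact) : Prop :=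
  E.IsCensor C ∧ ¬ ∃ C' : Set Fact, E.IsCensor C' ∧ C ⊂ C'

/-- The intersection of all the optimal GA censors of `E`. -/
def igaCensor : Set Fact := ⋂₀ {C | E.IsOptimalCensor C}

/-- `E` IGA-entails `q`. -/
def IGAEntails (q : BUCQ) : Prop := EntailsBUCQ E.tbox E.igaCensor q

end Inst

/-! ### ABoxes as strings; IGA-entailment in data complexity -/

/-- The alphabet in which ABoxes are written. -/
inductive Sym : Type where
  | bit (b : Bool)
  | lpar
  | comma
  | rpar
  deriving DecidableEq

/-- The string `A(a)` or `R(a,b)`. -/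
def encodeFact : Fact → List Sym
  | .concept A a => A.map Sym.bit ++ [Sym.lpar] ++ a.map Sym.bit ++ [Sym.rpar]
  | .role R a b =>
      R.map Sym.bit ++ [Sym.lpar] ++ a.map Sym.bit ++ [Sym.comma] ++ b.map Sym.bit ++ [Sym.rpar]

/-- The string `w` lists the facts of the ABox `A`, one after the other, in some order. -/
def Encodes (w : List Sym) (A : ABox) : Prop :=
  ∃ l : List Fact, (∀ α, α ∈ l ↔ α ∈ A) ∧ w = l.flatMap encodeFact

/-- IGA-entailment in data complexity: TBox, policy and query are fixed, the input is the ABox. -/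
def IGAEnt (T : TBox) (P : Policy) (q : BUCQ) : Language Sym :=
  {w | ∃ E : Inst, E.tbox = T ∧ E.policy = P ∧ Encodes w E.abox ∧ E.IGAEntails q}

end CQE

/-! ### Turing machines, logarithmic space, NL -/

namespace LogSpace

/-- The symbols that the input head can see: letters of the input and the two end markers. -/
inductive InSym (α : Type) : Type where
  | leftEnd
  | letter (a : α)
  | rightEnd

/-- Head movements. -/
inductive Move : Type where
  | left
  | stay
  | right

/-- The effect of a movement on a work head. -/
def Move.work (p : ℤ) : Move → ℤ
  | .left => p - 1
  | .stay => p
  | .right => p + 1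

/-- The effect of a movement on the input head, which stays between the end markers, at positions
`0` and `n + 1`, of an input of length `n`. -/
def Move.input (n p : ℕ) : Move → ℕ
  | .left => p - 1
  | .stay => p
  | .right => min (p + 1) (n + 1)

/-- The content of the input tape at a position. -/
def readInput {α : Type} (x : List α) : ℕ → InSym α
  | 0 => .leftEnd
  | p + 1 => match x[p]? with
    | some a => .letter a
    | none => .rightEnd

/-- What a machine does in one step: next state, symbols written on the work tapes, movements of
the input head and of the work heads, and at most one symbol appended to the output. -/
structure Action (β Q Γ κ : Type) : Type where
  next : Q
  write : κ → Γ
  moveInput : Move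
  moveWork : κ → Move
  out : Option β

/-- Nondeterministic Turing machines with a two-way read-only input tape over `α`, a finite set
`Tapes` of two-way infinite work tapes, and a write-only output tape over `β`. -/
structure Machine (α β : Type) : Type 1 where
  Q : Type
  Γ : Type
  Tapes : Type
  finQ : Finite Q
  finΓ : Finite Γ
  finTapes : Finite Tapes
  start : Q
  accept : Set Q
  blank : Γ
  trans : Q → InSym α → (Tapes → Γ) → Set (Action β Q Γ Tapes)

namespace Machine

variable {α β : Type} (M : Machine α β)

/-- Configurations. -/
structure Cfg : Type where
  state : M.Q
  inputHead : ℕ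
  tape : M.Tapes → ℤ → M.Γ
  head : M.Tapes → ℤ
  output : List β

/-- The initial configuration: all work tapes are blank, the output is empty. -/
def init : M.Cfg where
  state := M.start
  inputHead := 0
  tape := fun _ _ => M.blank
  head := fun _ => 0
  output := []

variable {M} in
/-- The configuration after performing an action on an input of length `n`. -/
def Cfg.apply (n : ℕ) (c : M.Cfg) (a : Action β M.Q M.Γ M.Tapes) : M.Cfg where
  state := a.next
  inputHead := a.moveInput.input n c.inputHead
  tape := fun i => Function.update (c.tape i) (c.head i) (a.write i)
  head := fun i => (a.moveWork i).work (c.head i)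
  output := c.output ++ a.out.toList

/-- One step on the input `x`. -/
def Step (x : List α) (c c' : M.Cfg) : Prop :=
  ∃ a ∈ M.trans c.state (readInput x c.inputHead) (fun i => c.tape i (c.head i)),
    c' = c.apply x.length a

/-- `c` occurs in some computation on the input `x`. -/
def Reaches (x : List α) (c : M.Cfg) : Prop := Relation.ReflTransGen (M.Step x) M.init c

/-- In all computations on inputs of length `n`, the work heads stay within distance `O(log n)` of
their initial positions; so only `O(log n)` work cells are ever used. -/
def RunsInLogSpace : Prop :=
  ∃ K : ℕ, ∀ (x : List α) (c : M.Cfg), M.Reaches x c →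
    ∀ i, |c.head i| ≤ ((K * (Nat.log 2 x.length + 1) : ℕ) : ℤ)

/-- Some computation on `x` reaches an accepting state. -/
def Accepts (x : List α) : Prop := ∃ c : M.Cfg, M.Reaches x c ∧ c.state ∈ M.accept

/-- At most one action is possible in every situation. -/
def IsDeterministic : Prop := ∀ q s g, (M.trans q s g).Subsingleton

/-- On every input `x`, some computation halts with output `f x`. -/
def Computes (f : List α → List β) : Prop :=
  ∀ x, ∃ c : M.Cfg, M.Reaches x c ∧ (∀ c', ¬ M.Step x c c') ∧ c.output = f x

end Machine

/-- The complexity class NL: languages accepted by nondeterministic machines in logarithmic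
space. -/
def InNL {α : Type} (L : Language α) : Prop :=
  ∃ M : Machine α Empty, M.RunsInLogSpace ∧ ∀ x, x ∈ L ↔ M.Accepts x

/-- Functions computed by deterministic machines in logarithmic space. -/
def LogSpaceComputable {α β : Type} (f : List α → List β) : Prop :=
  ∃ M : Machine α β, M.IsDeterministic ∧ M.RunsInLogSpace ∧ M.Computes f

/-- Logspace many-one reducibility. -/
def LogSpaceReducible {α β : Type} (L : Language α) (L' : Language β) : Prop :=
  ∃ f : List α → List β, LogSpaceComputable f ∧ ∀ x, x ∈ L ↔ f x ∈ L'

/-- `L'` is NL-hard: every language in NL, over any finite alphabet, is logspace many-one reducible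
to `L'`. -/
def NLHard {β : Type} (L' : Language β) : Prop :=
  ∀ (α : Type) [Finite α] (L : Language α), InNL L → LogSpaceReducible L L'

end LogSpace

/-! The policy is K R(x,y) → K ∃z R(y,z) and the query is ∃x,y R(x,y), where R is the role with the
empty name. With an empty TBox, a censor is a set of facts of the ABox in which the target of every
edge has an outgoing edge. Such sets are closed under union, so the only optimal censor is the
greatest one, and the query is IGA-entailed exactly if some censor has an edge
(`igaEntails_edgeQuery`). Since the ABox is finite, this means that R has a directed cycle.

It remains to reduce acceptance by a logspace machine to the existence of a cycle. The nodes are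
configurations with a clock value. Machine steps advance the clock by one, and every accepting node,
whatever its clock value, has an edge back to the initial node at time zero. As the clock is
bounded, an infinite walk must use a back edge and so visit the initial node; from there it follows
a genuine computation until the next back edge, which leaves an accepting configuration
(`accepts_of_forall_exists_edge`). Without the clock, any looping computation would be a cycle.
Conversely, a shortest accepting path fits on the clock and is closed by a back edge
(`exists_cycle_of_accepts`).

For the graph to be printable in logarithmic space, nodes are words of logarithmic length over a
finite alphabet. Work tapes are stored circularly and relative to the heads, so that moving a head
is a shift of the tape, which is a condition on neighbouring cells (`shifts_iff`). Changes of the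
clock and of the input position become digitwise additions with guessed carries (`exists_adds`).
Hence an edge is witnessed by a word that a finite automaton can check once it knows the input
letter under the head (`Tiling`). An `Enumerator` machine runs through all input positions and all
words, and prints an edge for each accepted word (`exists_logSpaceComputable_edges`). -/

namespace LogSpace

/-! ### Space-bounded halting runs of deterministic machines. -/

namespace Machine

variable {α β : Type} {M : Machine α β}

/-- One step to a configuration whose work heads are within distance `B` of the origin. -/
def BoundedStep (M : Machine α β) (x : List α) (B : ℕ) (c c' : M.Cfg) : Prop :=
  M.Step x c c' ∧ ∀ i, |c'.head i| ≤ (B : ℤ)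

/-- A deterministic machine with a halting bounded computation has no other configurations. -/
theorem head_le_of_halting_run (hM : M.IsDeterministic) {x : List α} {B : ℕ} {f : M.Cfg}
    (hrun : Relation.ReflTransGen (M.BoundedStep x B) M.init f) (hf : ∀ c, ¬ M.Step x f c)
    {c : M.Cfg} (hc : M.Reaches x c) : ∀ i, |c.head i| ≤ (B : ℤ) := by
  -- The invariant has to include that `c` still lies on the run to `f`; determinism then identifies
  -- the next step with that of the run.
  suffices h : (∀ i, |c.head i| ≤ (B : ℤ)) ∧ Relation.ReflTransGen (M.BoundedStep x B) c f from h.1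
  induction hc with
  | refl => exact ⟨fun i => by simp [init], hrun⟩
  | tail _ hstep ih =>
    rcases ih.2.cases_head with rfl | ⟨d, hd, hdf⟩
    · exact absurd hstep (hf _)
    · obtain ⟨a, ha, rfl⟩ := hstep
      obtain ⟨⟨a', ha', rfl⟩, hb⟩ := hd
      obtain rfl := hM _ _ _ ha ha'
      exact ⟨hb, hdf⟩

theorem reaches_of_boundedRun {x : List α} {B : ℕ} {f : M.Cfg}
    (hrun : Relation.ReflTransGen (M.BoundedStep x B) M.init f) : M.Reaches x f :=
  Relation.ReflTransGen.mono (fun _ _ h => h.1) _ _ hrun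

end Machine

/-! ### A logspace transducer that enumerates and filters words. -/

/-- Data of a machine that enumerates, for every position of its input, all words of a fixed
logarithmic length over a finite alphabet, and prints something for the words which pass the test of
a finite automaton. The cells of the words carry in addition the binary digits of the position. -/
structure Enumerator (α β : Type) : Type 1 where
  /-- The alphabet of the words has `m + 1` letters. -/
  m : ℕ
  /-- States of the automaton. -/
  D : Type
  finD : Finite D
  /-- The initial state of the automaton depends on the input letter at the current position. -/
  start : InSym α → D
  step : D → Bool × Fin (m + 1) → D
  acc : D → Bool
  /-- What is printed for a word: constants, or letterwise images of the word. -/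
  prog : List (β ⊕ (Bool × Fin (m + 1) → β))

namespace Enumerator

variable {α β : Type} (N : Enumerator α β)

abbrev Cell : Type := Bool × Fin (N.m + 1)

/-- The word of length `l` made of the binary digits of `i` and the `(m+1)`-ary digits of `t`. -/
def word : ℕ → ℕ → ℕ → List N.Cell
  | 0, _, _ => []
  | l + 1, i, t => (decide (i % 2 = 1), Fin.ofNat (N.m + 1) t) :: word l (i / 2) (t / (N.m + 1))

/-- What one item of the program prints for a word. -/
def itemOut (u : List N.Cell) : β ⊕ (N.Cell → β) → List β
  | .inl b => [b]
  | .inr h => u.map h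

/-- The automaton accepts the word. -/
def Accepted (s : InSym α) (u : List N.Cell) : Bool := N.acc (u.foldl N.step (N.start s))

/-- What is printed for a word. -/
def wordOut (s : InSym α) (u : List N.Cell) : List β :=
  if N.Accepted s u then N.prog.flatMap (N.itemOut u) else []

/-- The length of the words. -/
def len (x : List α) : ℕ := Nat.size (x.length + 1)

/-- What is printed for the position `i`. -/
def posOut (x : List α) (i : ℕ) : List β :=
  (List.range ((N.m + 1) ^ len x)).flatMap fun t => N.wordOut (readInput x i) (N.word (len x) i t)

/-- The whole output. -/
def output (x : List α) : List β := (List.range (x.length + 2)).reverse.flatMap (N.posOut x)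

/-- The arithmetic operations on the tape. -/
inductive Op : Type where
  | count
  | odometer
  | borrow

/-- The operation has to continue with the next cell. -/
def Op.cont {N : Enumerator α β} : Op → N.Cell → Bool
  | .count, c => c.1
  | .odometer, c => decide (c.2 = Fin.last N.m)
  | .borrow, c => !c.1

/-- The effect of an operation on a cell. -/
def Op.upd {N : Enumerator α β} : Op → N.Cell → N.Cell
  | .count, c => (!c.1, c.2)
  | .odometer, c => (c.1, c.2 + 1)
  | .borrow, c => (!c.1, c.2)

/-- The remaining parts of the program. -/
abbrev Rest : Type := {l : List (β ⊕ (N.Cell → β)) // l <:+ N.prog}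

def Rest.next {N : Enumerator α β} (l : N.Rest) : N.Rest :=
  ⟨l.1.tail, (List.tail_suffix _).trans l.2⟩

/-- States of the machine. In the states `count`, `loop`, `emit`, `borrow` the head returns to the
cell left of the word. -/
inductive State : Type where
  | count
  | carry (k : Op)
  | loop
  | check (d : N.D)
  | emit (l : N.Rest)
  | sweep (l : N.Rest)
  | borrow

theorem finite_state : Finite N.State := by
  have := N.finD
  have : Finite N.Rest := by
    refine Set.Finite.subset (List.finite_toSet N.prog.tails) fun l hl => ?_
    exact (List.mem_tails _ _).2 hl
  have : Finite Op := Finite.of_injective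
    (fun k : Op => match k with | .count => (0 : Fin 3) | .odometer => 1 | .borrow => 2)
    (by rintro (_ | _ | _) (_ | _ | _) h <;> simp_all)
  refine Finite.of_injective (β := Fin 3 ⊕ Op ⊕ N.D ⊕ N.Rest ⊕ N.Rest) (fun s => match s with
    | .count => .inl 0
    | .loop => .inl 1
    | .borrow => .inl 2
    | .carry k => .inr (.inl k)
    | .check d => .inr (.inr (.inl d))
    | .emit l => .inr (.inr (.inr (.inl l)))
    | .sweep l => .inr (.inr (.inr (.inr l)))) ?_
  intro a b h
  cases a <;> cases b <;> simp_all

variable {N} in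
def act (st : N.State) (w : Option N.Cell) (mi mw : Move) (o : Option β) :
    Action β N.State (Option N.Cell) Unit :=
  ⟨st, fun _ => w, mi, fun _ => mw, o⟩

/-- The state after an operation without overflow. -/
def Op.done (N : Enumerator α β) : Op → N.State
  | .count => .count
  | _ => .loop

/-- What is printed at a cell during a sweep. -/
def sweepOut {N : Enumerator α β} (l : N.Rest) (c : N.Cell) : Option β :=
  match l.1.head? with
  | some (.inr h) => some (h c)
  | _ => none

/-- The transition function. -/
def delta : N.State → InSym α → Option N.Cell → Option (Action β N.State (Option N.Cell) Unit)
  | .count, _, some c => some (act .count (some c) .stay .left none)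
  | .count, .rightEnd, none => some (act .loop none .stay .stay none)
  | .count, _, none => some (act (.carry .count) none .right .right none)
  | .carry k, _, some c =>
    if k.cont c then some (act (.carry k) (some (k.upd c)) .stay .right none)
    else some (act (k.done N) (some (k.upd c)) .stay .left none)
  | .carry .count, _, none => some (act .count (some (true, 0)) .stay .left none)
  | .carry .odometer, _, none => some (act .borrow none .stay .left none)
  | .carry .borrow, _, none => none
  | .loop, _, some c => some (act .loop (some c) .stay .left none)
  | .loop, s, none => some (act (.check (N.start s)) none .stay .right none)
  | .check d, _, some c => some (act (.check (N.step d c)) (some c) .stay .right none)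
  | .check d, _, none =>
    some (act (.emit (if N.acc d then ⟨N.prog, List.suffix_rfl⟩ else ⟨[], List.nil_suffix⟩))
      none .stay .left none)
  | .emit l, _, some c => some (act (.emit l) (some c) .stay .left none)
  | .emit l, _, none =>
    match l.1.head? with
    | none => some (act (.carry .odometer) none .stay .right none)
    | some (.inl b) => some (act (.emit l.next) none .stay .stay (some b))
    | some (.inr _) => some (act (.sweep l) none .stay .right none)
  | .sweep l, _, some c => some (act (.sweep l) (some c) .stay .right (sweepOut l c))
  | .sweep l, _, none => some (act (.emit l.next) none .stay .left none)
  | .borrow, _, some c => some (act .borrow (some c) .stay .left none)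
  | .borrow, .leftEnd, none => none
  | .borrow, _, none => some (act (.carry .borrow) none .left .right none)

/-- The machine. -/
abbrev machine : Machine α β where
  Q := N.State
  Γ := Option N.Cell
  Tapes := Unit
  finQ := N.finite_state
  finΓ := inferInstance
  finTapes := inferInstance
  start := .count
  accept := ∅
  blank := none
  trans := fun q s g => {a | N.delta q s (g ()) = some a}

theorem machine_isDeterministic : N.machine.IsDeterministic := by
  intro q s g a ha b hb
  exact Option.some.inj (ha.symm.trans hb)

/-- The tape with the word `u` in the cells `1, 2, …`. -/
def tape (u : List N.Cell) (z : ℤ) : Option N.Cell := if z ≤ 0 then none else u[(z - 1).toNat]?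

/-- Configurations with the word `u` on the tape. -/
def cfg (st : N.State) (i : ℕ) (u : List N.Cell) (p : ℕ) (o : List β) : N.machine.Cfg :=
  ⟨st, i, fun _ => N.tape u, fun _ => (p : ℤ), o⟩

variable {N}

theorem tape_zero (u : List N.Cell) : N.tape u 0 = none := by simp [tape]

theorem tape_succ (u : List N.Cell) (p : ℕ) : N.tape u ((p + 1 : ℕ) : ℤ) = u[p]? := by
  have : ¬ ((p : ℤ) + 1 ≤ 0) := by omega
  simp [tape, this]

theorem tape_end (u : List N.Cell) : N.tape u ((u.length + 1 : ℕ) : ℤ) = none := by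
  rw [tape_succ, List.getElem?_eq_none le_rfl]

theorem tape_nil : N.tape [] = fun _ => none := by
  funext z; simp [tape]

theorem tape_update (u : List N.Cell) (p : ℕ) (hp : p < u.length) (c : N.Cell) :
    Function.update (N.tape u) ((p + 1 : ℕ) : ℤ) (some c) = N.tape (u.set p c) := by
  funext z
  rcases le_or_gt z 0 with hz | hz
  · rw [Function.update_of_ne (by omega)]
    simp [tape, hz]
  · obtain ⟨j, rfl⟩ : ∃ j : ℕ, z = ((j + 1 : ℕ) : ℤ) := ⟨(z - 1).toNat, by omega⟩
    rw [tape_succ, List.getElem?_set]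
    by_cases h : j = p
    · subst h; simp [hp]
    · rw [Function.update_of_ne (by omega), tape_succ, if_neg (Ne.symm h)]

theorem tape_extend (u : List N.Cell) (c : N.Cell) :
    Function.update (N.tape u) ((u.length + 1 : ℕ) : ℤ) (some c) = N.tape (u ++ [c]) := by
  funext z
  rcases le_or_gt z 0 with hz | hz
  · rw [Function.update_of_ne (by omega)]
    simp [tape, hz]
  · obtain ⟨j, rfl⟩ : ∃ j : ℕ, z = ((j + 1 : ℕ) : ℤ) := ⟨(z - 1).toNat, by omega⟩
    rw [tape_succ]
    rcases lt_trichotomy j u.length with h | h | h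
    · rw [Function.update_of_ne (by omega), tape_succ, List.getElem?_append_left h]
    · subst h; simp
    · rw [Function.update_of_ne (by omega), tape_succ, List.getElem?_eq_none (by omega),
        List.getElem?_eq_none (by simp; omega)]

/-! ### Elementary runs of the transducer on one word. -/

variable {x : List α} {B i p p' i' : ℕ} {u : List N.Cell} {o : List β} {st st' : N.State}
  {mi mw : Move} {ob : Option β}

/-- A step in which the head reads a cell of the word. -/
theorem step_cell {c c' : N.Cell} (hu : u[p]? = some c)
    (hd : N.delta st (readInput x i) (some c) = some (act st' (some c') .stay mw ob))
    (hp' : mw.work ((p + 1 : ℕ) : ℤ) = (p' : ℤ)) (hB : p' ≤ B) :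
    N.machine.BoundedStep x B (N.cfg st i u (p + 1) o)
      (N.cfg st' i (u.set p c') p' (o ++ ob.toList)) := by
  have hp : p < u.length := by
    by_contra h
    rw [List.getElem?_eq_none (by omega)] at hu
    cases hu
  refine ⟨⟨act st' (some c') .stay mw ob, ?_, ?_⟩, fun _ => ?_⟩
  · have : N.delta st (readInput x i) (N.tape u ((p + 1 : ℕ) : ℤ)) =
        some (act st' (some c') .stay mw ob) := by rw [tape_succ, hu, hd]
    exact this
  · simp only [Machine.Cfg.apply, cfg, act, hp', Move.input]
    exact congrArg (fun t => (⟨st', i, fun _ => t, fun _ => (p' : ℤ), o ++ ob.toList⟩ :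
      N.machine.Cfg)) (tape_update u p hp c').symm
  · simp [cfg, hB]

/-- A step in which the head reads a cell of the word and leaves it unchanged. -/
theorem step_keep {c : N.Cell} (hu : u[p]? = some c)
    (hd : N.delta st (readInput x i) (some c) = some (act st' (some c) .stay mw ob))
    (hp' : mw.work ((p + 1 : ℕ) : ℤ) = (p' : ℤ)) (hB : p' ≤ B) :
    N.machine.BoundedStep x B (N.cfg st i u (p + 1) o) (N.cfg st' i u p' (o ++ ob.toList)) := by
  have := step_cell (o := o) hu hd hp' hB
  obtain ⟨h, rfl⟩ := List.getElem?_eq_some_iff.1 hu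
  rwa [List.set_getElem_self] at this

/-- A step in which the head reads a blank. -/
theorem step_blank (hu : N.tape u p = none)
    (hd : N.delta st (readInput x i) none = some (act st' none mi mw ob))
    (hp' : mw.work (p : ℤ) = (p' : ℤ)) (hi : mi.input x.length i = i') (hB : p' ≤ B) :
    N.machine.BoundedStep x B (N.cfg st i u p o) (N.cfg st' i' u p' (o ++ ob.toList)) := by
  refine ⟨⟨act st' none mi mw ob, ?_, ?_⟩, fun _ => ?_⟩
  · have : N.delta st (readInput x i) (N.tape u (p : ℤ)) = some (act st' none mi mw ob) := by
      rw [hu, hd]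
    exact this
  · have : Function.update (N.tape u) (p : ℤ) none = N.tape u := by
      rw [← hu, Function.update_eq_self]
    simp only [Machine.Cfg.apply, cfg, act, hp', hi]
    exact congrArg (fun t => (⟨st', i', fun _ => t, fun _ => (p' : ℤ), o ++ ob.toList⟩ :
      N.machine.Cfg)) this.symm
  · simp [cfg, hB]

/-- The run relation of the machine within the bound `B`. -/
abbrev Run (N : Enumerator α β) (x : List α) (B : ℕ) : N.machine.Cfg → N.machine.Cfg → Prop :=
  Relation.ReflTransGen (N.machine.BoundedStep x B)

/-- In a returning state, the head reaches the cell left of the word. -/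
theorem run_return (hst : ∀ c, N.delta st (readInput x i) (some c) =
      some (act st (some c) .stay .left none)) (hp : p ≤ u.length) (hB : p ≤ B) :
    N.Run x B (N.cfg st i u p o) (N.cfg st i u 0 o) := by
  induction p with
  | zero => exact .refl
  | succ p ih =>
    refine Relation.ReflTransGen.head ?_ (ih (by omega) (by omega))
    have := step_keep (o := o) (p' := p) (B := B) (List.getElem?_eq_getElem (by omega)) (hst u[p])
      (by simp [Move.work]) (by omega)
    simpa using this

/-- The effect of an operation on a word, and whether there is an overflow. -/
def carry (k : Op) : List N.Cell → List N.Cell × Bool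
  | [] => ([], true)
  | c :: u => if k.cont c then (k.upd c :: (carry k u).1, (carry k u).2) else (k.upd c :: u, false)

theorem length_carry (k : Op) (u : List N.Cell) : (carry k u).1.length = u.length := by
  induction u with
  | nil => rfl
  | cons c u ih => by_cases h : k.cont c <;> simp [carry, h, ih]

/-- The prefix `v` is the part already passed; generalizing over it lets the induction follow the
head. Without overflow the final head position `p` may stay unspecified, because the machine ends in
a returning state. -/
theorem run_carry_append (k : Op) (v u : List N.Cell) (hB : v.length + u.length + 1 ≤ B) :
    if (carry k u).2 then
      N.Run x B (N.cfg (.carry k) i (v ++ u) (v.length + 1) o)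
        (N.cfg (.carry k) i (v ++ (carry k u).1) (v.length + u.length + 1) o)
    else ∃ p ≤ v.length + u.length,
      N.Run x B (N.cfg (.carry k) i (v ++ u) (v.length + 1) o)
        (N.cfg (k.done N) i (v ++ (carry k u).1) p o) := by
  induction u generalizing v with
  | nil => simp [carry, Relation.ReflTransGen.refl]
  | cons c u ih =>
    have hc : (v ++ c :: u)[v.length]? = some c := by simp
    by_cases h : k.cont c
    · have ih := ih (v ++ [k.upd c]) (by simp at hB ⊢; omega)
      have hstep : N.machine.BoundedStep x B (N.cfg (.carry k) i (v ++ c :: u) (v.length + 1) o)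
          (N.cfg (.carry k) i (v ++ [k.upd c] ++ u) ((v ++ [k.upd c]).length + 1) o) := by
        have := step_cell (x := x) (i := i) (o := o) (st := .carry k) (st' := .carry k) (B := B)
          (c' := k.upd c) (p' := v.length + 2) (mw := .right) (ob := none) hc (by simp [delta, h])
          (by simp [Move.work]; ring) (by simp at hB; omega)
        simpa using this
      simp only [carry, h, if_true]
      split_ifs at ih ⊢ with h2
      · have := Relation.ReflTransGen.head hstep ih
        simpa [add_assoc, add_comm, add_left_comm] using this
      · obtain ⟨p, hp, hr⟩ := ih
        refine ⟨p, by simp at hp ⊢; omega, ?_⟩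
        simpa using Relation.ReflTransGen.head hstep hr
    · have := step_cell (x := x) (i := i) (o := o) (st := .carry k)
          (st' := k.done N) (B := B)
          (c' := k.upd c) (p' := v.length) (mw := .left) (ob := none) hc (by simp [delta, h])
          (by simp [Move.work]) (by omega)
      simp only [carry, h]
      refine ⟨v.length, by omega, Relation.ReflTransGen.single ?_⟩
      simpa using this

theorem run_carry_done {k : Op} (h : (carry k u).2 = false) (hB : u.length + 1 ≤ B) :
    N.Run x B (N.cfg (.carry k) i u 1 o)
      (N.cfg (k.done N) i (carry k u).1 0 o) := by
  have := run_carry_append (x := x) (i := i) (o := o) (B := B) k [] u (by simpa using hB)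
  simp only [h] at this
  obtain ⟨p, hp, hr⟩ := this
  simp only [List.length_nil, Nat.zero_add, List.nil_append] at hr hp
  refine hr.trans (run_return (fun c => ?_) ?_ ?_)
  · cases k <;> rfl
  · rwa [length_carry]
  · omega

theorem run_carry_overflow {k : Op} (h : (carry k u).2 = true) (hB : u.length + 1 ≤ B) :
    N.Run x B (N.cfg (.carry k) i u 1 o)
      (N.cfg (.carry k) i (carry k u).1 (u.length + 1) o) := by
  have := run_carry_append (x := x) (i := i) (o := o) (B := B) k [] u (by simpa using hB)
  simpa [h] using this

theorem run_check_append (d : N.D) (v u : List N.Cell) (hB : v.length + u.length + 1 ≤ B) :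
    N.Run x B (N.cfg (.check d) i (v ++ u) (v.length + 1) o)
      (N.cfg (.check (u.foldl N.step d)) i (v ++ u) (v.length + u.length + 1) o) := by
  induction u generalizing v d with
  | nil => simpa using Relation.ReflTransGen.refl
  | cons c u ih =>
    have ih := ih (N.step d c) (v ++ [c]) (by simp at hB ⊢; omega)
    have := step_keep (x := x) (i := i) (o := o) (st := .check d) (st' := .check (N.step d c))
      (B := B) (p := v.length) (u := v ++ c :: u) (c := c) (p' := v.length + 2) (mw := .right)
      (ob := none) (by simp) (by simp [delta]) (by simp [Move.work]; ring) (by simp at hB; omega)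
    refine Relation.ReflTransGen.head (by simpa using this) ?_
    convert ih using 2
    all_goals simp
    all_goals omega

theorem run_check (s : InSym α) (hs : readInput x i = s) (hB : u.length + 1 ≤ B) :
    N.Run x B (N.cfg .loop i u 0 o)
      (N.cfg (.emit (if N.Accepted s u then ⟨N.prog, List.suffix_rfl⟩ else ⟨[], List.nil_suffix⟩))
        i u 0 o) := by
  have h₁ := step_blank (x := x) (i := i) (i' := i) (o := o) (B := B) (u := u) (p := 0) (p' := 1)
    (st := .loop) (st' := .check (N.start s)) (mi := .stay) (mw := .right) (ob := none)
    (tape_zero u) (by simp [delta, hs]) (by simp [Move.work]) rfl (by omega)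
  have h₂ := run_check_append (x := x) (i := i) (o := o) (B := B) (N.start s) [] u
    (by simpa using hB)
  have h₃ := step_blank (x := x) (i := i) (i' := i) (o := o) (B := B) (u := u) (p := u.length + 1)
    (p' := u.length) (st := .check (u.foldl N.step (N.start s)))
    (st' := .emit (if N.Accepted s u then ⟨N.prog, List.suffix_rfl⟩ else ⟨[], List.nil_suffix⟩))
    (mi := .stay) (mw := .left) (ob := none)
    (tape_end u) rfl (by simp [Move.work]) rfl (by omega)
  simp only [Option.toList_none, List.append_nil] at h₁ h₃
  refine Relation.ReflTransGen.head h₁ (Relation.ReflTransGen.trans ?_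
    (Relation.ReflTransGen.head h₃ (run_return (fun c => rfl) le_rfl (by omega))))
  simpa using h₂

theorem run_sweep_append {l : N.Rest} {h : N.Cell → β} (hl : l.1.head? = some (.inr h))
    (v u : List N.Cell) (hB : v.length + u.length + 1 ≤ B) :
    N.Run x B (N.cfg (.sweep l) i (v ++ u) (v.length + 1) o)
      (N.cfg (.sweep l) i (v ++ u) (v.length + u.length + 1) (o ++ u.map h)) := by
  induction u generalizing v o with
  | nil => simpa using Relation.ReflTransGen.refl
  | cons c u ih =>
    have ih := ih (o := o ++ [h c]) (v ++ [c]) (by simp at hB ⊢; omega)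
    have := step_keep (x := x) (i := i) (o := o) (st := .sweep l) (st' := .sweep l)
      (B := B) (p := v.length) (u := v ++ c :: u) (c := c) (p' := v.length + 2) (mw := .right)
      (ob := some (h c)) (by simp) (by simp [delta, sweepOut, hl]) (by simp [Move.work]; ring)
      (by simp at hB; omega)
    refine Relation.ReflTransGen.head (by simpa using this) ?_
    convert ih using 2
    all_goals simp
    all_goals omega

theorem run_emit (l : N.Rest) (hB : u.length + 1 ≤ B) :
    N.Run x B (N.cfg (.emit l) i u 0 o)
      (N.cfg (.carry .odometer) i u 1 (o ++ l.1.flatMap (N.itemOut u))) := by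
  obtain ⟨l, hl⟩ := l
  induction l generalizing o with
  | nil =>
    have := step_blank (x := x) (i := i) (i' := i) (o := o) (B := B) (u := u) (p := 0) (p' := 1)
      (st := .emit ⟨[], hl⟩) (st' := .carry .odometer) (mi := .stay) (mw := .right) (ob := none)
      (tape_zero u) (by simp [delta]) (by simp [Move.work]) rfl (by omega)
    exact Relation.ReflTransGen.single (by simpa using this)
  | cons a l ih =>
    have hl' : l <:+ N.prog := (List.suffix_cons a l).trans hl
    have hnext : Rest.next ⟨a :: l, hl⟩ = (⟨l, hl'⟩ : N.Rest) := rfl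
    rcases a with b | h
    · have := step_blank (x := x) (i := i) (i' := i) (o := o) (B := B) (u := u) (p := 0) (p' := 0)
        (st := .emit ⟨.inl b :: l, hl⟩) (st' := .emit ⟨l, hl'⟩) (mi := .stay) (mw := .stay)
        (ob := some b) (tape_zero u) (by simp [delta, hnext]) (by simp [Move.work]) rfl (by omega)
      refine Relation.ReflTransGen.head this ?_
      simpa [itemOut] using ih (o := o ++ [b]) hl'
    · have h₁ := step_blank (x := x) (i := i) (i' := i) (o := o) (B := B) (u := u) (p := 0) (p' := 1)
        (st := .emit ⟨.inr h :: l, hl⟩) (st' := .sweep ⟨.inr h :: l, hl⟩) (mi := .stay)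
        (mw := .right) (ob := none) (tape_zero u) (by simp [delta]) (by simp [Move.work]) rfl
        (by omega)
      have h₂ := run_sweep_append (x := x) (i := i) (o := o) (B := B)
        (l := ⟨.inr h :: l, hl⟩) (h := h) rfl [] u (by simpa using hB)
      have h₃ := step_blank (x := x) (i := i) (i' := i) (o := o ++ u.map h) (B := B) (u := u)
        (p := u.length + 1) (p' := u.length) (st := .sweep ⟨.inr h :: l, hl⟩)
        (st' := .emit ⟨l, hl'⟩) (mi := .stay) (mw := .left) (ob := none)
        (tape_end u) (by simp [delta, hnext]) (by simp [Move.work]) rfl (by omega)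
      simp only [Option.toList_none, List.append_nil] at h₁ h₃
      refine Relation.ReflTransGen.head h₁ (Relation.ReflTransGen.trans (by simpa using h₂)
        (Relation.ReflTransGen.head h₃
          ((run_return (fun c => rfl) le_rfl (by omega)).trans ?_)))
      simpa [itemOut] using ih (o := o ++ u.map h) hl'

/-- Test of a word and output. -/
theorem run_word (s : InSym α) (hs : readInput x i = s) (hB : u.length + 1 ≤ B) :
    N.Run x B (N.cfg .loop i u 0 o) (N.cfg (.carry .odometer) i u 1 (o ++ N.wordOut s u)) := by
  refine (run_check s hs hB).trans ?_
  convert run_emit (N := N) _ hB using 2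
  unfold wordOut
  split_ifs <;> simp

end Enumerator

end LogSpace

/-! ### The tape operations as arithmetic on digits. -/

namespace LogSpace

namespace Enumerator

variable {α β : Type} {N : Enumerator α β}

theorem length_word (l i t : ℕ) : (N.word l i t).length = l := by
  induction l generalizing i t with
  | zero => rfl
  | succ l ih => simp [word, ih]

/-- The binary track holds `i` only modulo `2 ^ l`, so the carry leaves the word exactly when `i +
1` vanishes modulo `2 ^ l`. -/
theorem carry_count_word (l i t : ℕ) :
    carry .count (N.word l i t) = (N.word l (i + 1) t, decide (2 ^ l ∣ i + 1)) := by
  induction l generalizing i t with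
  | zero => simp [word, carry]
  | succ l ih =>
    rcases Nat.even_or_odd' i with ⟨j, rfl | rfl⟩
    · have h₁ : (2 * j + 1) / 2 = j := by omega
      have h₂ : ¬ 2 ^ (l + 1) ∣ 2 * j + 1 := fun h => by
        have := (Dvd.intro_left (2 ^ l) (pow_succ 2 l).symm).trans h
        omega
      simp [word, carry, Op.cont, Op.upd, h₁, h₂]
    · have h₁ : (2 * j + 1) / 2 = j := by omega
      have h₂ : (2 * j + 1 + 1) / 2 = j + 1 := by omega
      have h₃ : 2 ^ (l + 1) ∣ 2 * j + 1 + 1 ↔ 2 ^ l ∣ j + 1 := by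
        rw [pow_succ', show 2 * j + 1 + 1 = 2 * (j + 1) by ring,
          Nat.mul_dvd_mul_iff_left (by norm_num)]
      have h₄ : (2 * j + 1 + 1) % 2 = 0 := by omega
      simp [word, carry, Op.cont, Op.upd, h₁, h₂, h₃, h₄, ih]

/-- Decrementing undoes `carry_count_word`: both flip the same digits, and they overflow for the
same `i`. -/
theorem carry_borrow_word (l i t : ℕ) :
    carry .borrow (N.word l (i + 1) t) = (N.word l i t, decide (2 ^ l ∣ i + 1)) := by
  induction l generalizing i t with
  | zero => simp [word, carry]
  | succ l ih =>
    rcases Nat.even_or_odd' i with ⟨j, rfl | rfl⟩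
    · have h₁ : (2 * j + 1) / 2 = j := by omega
      have h₂ : ¬ 2 ^ (l + 1) ∣ 2 * j + 1 := fun h => by
        have := (Dvd.intro_left (2 ^ l) (pow_succ 2 l).symm).trans h
        omega
      simp [word, carry, Op.cont, Op.upd, h₁, h₂]
    · have h₁ : (2 * j + 1) / 2 = j := by omega
      have h₂ : (2 * j + 1 + 1) / 2 = j + 1 := by omega
      have h₃ : 2 ^ (l + 1) ∣ 2 * j + 1 + 1 ↔ 2 ^ l ∣ j + 1 := by
        rw [pow_succ', show 2 * j + 1 + 1 = 2 * (j + 1) by ring,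
          Nat.mul_dvd_mul_iff_left (by norm_num)]
      have h₄ : (2 * j + 1 + 1) % 2 = 0 := by omega
      simp [word, carry, Op.cont, Op.upd, h₁, h₂, h₃, h₄, ih]

theorem carry_odometer_word (l i t : ℕ) :
    carry .odometer (N.word l i t) = (N.word l i (t + 1), decide ((N.m + 1) ^ l ∣ t + 1)) := by
  induction l generalizing i t with
  | zero => simp [word, carry]
  | succ l ih =>
    have hadd : Fin.ofNat (N.m + 1) t + 1 = Fin.ofNat (N.m + 1) (t + 1) := by
      ext; simp [Fin.val_add]
    by_cases h : N.m + 1 ∣ t + 1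
    · have hl : Fin.ofNat (N.m + 1) t = Fin.last N.m := by
        obtain ⟨d, hd⟩ := h
        ext
        simp only [Fin.val_ofNat, Fin.val_last]
        obtain ⟨d, rfl⟩ : ∃ e, d = e + 1 := ⟨d - 1, by
          rcases d with _ | d
          · omega
          · rfl⟩
        rw [show t = N.m + (N.m + 1) * d by linarith, Nat.add_mul_mod_self_left,
          Nat.mod_eq_of_lt (by omega)]
      have h₁ : (t + 1) / (N.m + 1) = t / (N.m + 1) + 1 := by
        rw [Nat.succ_div, if_pos h]
      have h₂ : (N.m + 1) ^ (l + 1) ∣ t + 1 ↔ (N.m + 1) ^ l ∣ t / (N.m + 1) + 1 := by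
        rw [← h₁, pow_succ, Nat.dvd_div_iff_mul_dvd h, mul_comm]
      simp [word, carry, Op.cont, Op.upd, hl, ih, h₁, h₂, ← hadd, -Fin.ofNat_eq_cast]
    · have hl : Fin.ofNat (N.m + 1) t ≠ Fin.last N.m := fun e => h <| by
        have e := congrArg Fin.val e
        simp only [Fin.val_ofNat, Fin.val_last] at e
        rw [Nat.dvd_iff_mod_eq_zero, Nat.add_mod, e]
        rcases N.m with _ | m <;> simp
      have h₁ : (t + 1) / (N.m + 1) = t / (N.m + 1) := by
        rw [Nat.succ_div, if_neg h]
        rfl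
      have h₂ : ¬ (N.m + 1) ^ (l + 1) ∣ t + 1 := fun e =>
        h ((Dvd.intro_left _ (pow_succ _ l).symm).trans e)
      simp [word, carry, Op.cont, Op.upd, hl, h₁, h₂, ← hadd, -Fin.ofNat_eq_cast]

/-- The overflowing odometer shows zeros again, so the tape is ready for the next input position
without any cleaning. -/
theorem word_pow (l i : ℕ) : N.word l i ((N.m + 1) ^ l) = N.word l i 0 := by
  induction l generalizing i with
  | zero => rfl
  | succ l ih =>
    have : Fin.ofNat (N.m + 1) ((N.m + 1) ^ (l + 1)) = Fin.ofNat (N.m + 1) 0 := by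
      ext; simp [pow_succ]
    rw [word, this]
    simp only [word, pow_succ, Nat.mul_div_left _ (Nat.succ_pos N.m), ih, Nat.zero_div]

/-- At an overflow of the counter its `l` digits are all zero; a digit one appended at the top
completes the binary notation of `2 ^ l`. This is how the word grows to logarithmic length. -/
theorem word_two_pow_append (l : ℕ) :
    N.word l (2 ^ l) 0 ++ [(true, 0)] = N.word (l + 1) (2 ^ l) 0 := by
  induction l with
  | zero => simp [word]
  | succ l ih =>
    have h : 2 ^ (l + 1) / 2 = 2 ^ l := by rw [pow_succ]; omega
    rw [word, word, List.cons_append, Nat.zero_div, h, ih]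

/-- The words are those with the digits of the position in the first components. -/
theorem exists_word_eq (l t : ℕ) :
    ∃ w : Fin l → Fin (N.m + 1), ∀ i, N.word l i t = List.ofFn fun j => (i.testBit j, w j) := by
  induction l generalizing t with
  | zero => exact ⟨Fin.elim0, fun i => by simp [word]⟩
  | succ l ih =>
    obtain ⟨w, hw⟩ := ih (t / (N.m + 1))
    refine ⟨Fin.cons (Fin.ofNat _ t) w, fun i => ?_⟩
    simp [word, List.ofFn_succ, hw, Nat.testBit_succ]

theorem exists_eq_word (l : ℕ) (w : Fin l → Fin (N.m + 1)) :
    ∃ t < (N.m + 1) ^ l, ∀ i, N.word l i t = List.ofFn fun j => (i.testBit j, w j) := by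
  induction l with
  | zero => exact ⟨0, by simp, fun i => by simp [word]⟩
  | succ l ih =>
    obtain ⟨t, ht, hw⟩ := ih (Fin.tail w)
    refine ⟨w 0 + (N.m + 1) * t, ?_, fun i => ?_⟩
    · have h₁ := (w 0).isLt
      have h₂ : (N.m + 1) * (t + 1) ≤ (N.m + 1) * (N.m + 1) ^ l := Nat.mul_le_mul_left _ ht
      rw [pow_succ']
      linarith
    · have h₁ : (w 0 + (N.m + 1) * t) / (N.m + 1) = t := by
        rw [Nat.add_mul_div_left _ _ (Nat.succ_pos _), Nat.div_eq_of_lt (w 0).isLt, zero_add]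
      have h₂ : Fin.ofNat (N.m + 1) (w 0 + (N.m + 1) * t) = w 0 := by
        ext
        simp only [Fin.val_ofNat, Nat.add_mul_mod_self_left]
        exact Nat.mod_eq_of_lt (w 0).isLt
      simp [word, List.ofFn_succ, h₁, h₂, hw, Nat.testBit_succ, Fin.tail, -Fin.ofNat_eq_cast]

/-! ### The complete run of the transducer. -/

variable {x : List α} {o : List β} {B i : ℕ}

theorem readInput_ne_rightEnd (hi : i ≤ x.length) : readInput x i ≠ .rightEnd := by
  rcases i with _ | i
  · simp [readInput]
  · simp [readInput, List.getElem?_eq_getElem (show i < x.length by omega)]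

theorem readInput_length_succ : readInput x (x.length + 1) = .rightEnd := by
  simp [readInput]

theorem readInput_succ_ne_leftEnd : readInput x (i + 1) ≠ .leftEnd := by
  simp only [readInput]
  split <;> simp

/-- Since `i < 2 ^ Nat.size i`, divisibility forces equality: the counter overflows only at powers
of two, just when the binary length grows. -/
theorem size_succ_of_dvd (h : 2 ^ Nat.size i ∣ i + 1) :
    i + 1 = 2 ^ Nat.size i ∧ Nat.size (i + 1) = Nat.size i + 1 := by
  have h₁ : i + 1 = 2 ^ Nat.size i :=
    le_antisymm (Nat.lt_size_self i) (Nat.le_of_dvd (Nat.succ_pos i) h)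
  exact ⟨h₁, by rw [h₁, Nat.size_pow]⟩

theorem size_succ_of_not_dvd (h : ¬ 2 ^ Nat.size i ∣ i + 1) : Nat.size (i + 1) = Nat.size i := by
  refine le_antisymm (Nat.size_le.2 ?_) (Nat.size_le_size (Nat.le_succ i))
  exact lt_of_le_of_ne (Nat.lt_size_self i) fun e => h (e ▸ dvd_rfl)

/-- The counting phase. -/
theorem run_count (hB : len x + 1 ≤ B) (hi : i ≤ x.length + 1) :
    N.Run x B N.machine.init (N.cfg .count i (N.word (Nat.size i) i 0) 0 []) := by
  induction i with
  | zero =>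
    have : N.machine.init = N.cfg .count 0 (N.word (Nat.size 0) 0 0) 0 [] := by
      simp [Machine.init, cfg, word, tape_nil]
    rw [this]
  | succ i ih =>
    have hs : Nat.size i + 1 ≤ B := (Nat.succ_le_succ (Nat.size_le_size (by omega))).trans hB
    have h₁ := step_blank (x := x) (i := i) (i' := i + 1) (o := []) (B := B)
      (u := N.word (Nat.size i) i 0) (p := 0) (p' := 1)
      (st := .count) (st' := .carry .count) (mi := .right) (mw := .right) (ob := none)
      (tape_zero _) (by
        have := readInput_ne_rightEnd (x := x) (i := i) (by omega)
        cases h : readInput x i <;> simp_all [delta]) (by simp [Move.work])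
      (by simp [Move.input]; omega) (by omega)
    refine (ih (by omega)).trans (Relation.ReflTransGen.head h₁ ?_)
    simp only [Option.toList_none, List.append_nil]
    by_cases hd : 2 ^ Nat.size i ∣ i + 1
    · obtain ⟨hi', hsz⟩ := size_succ_of_dvd hd
      have hB' : Nat.size i + 1 + 1 ≤ B := by
        rw [← hsz]
        exact (Nat.succ_le_succ (Nat.size_le_size (by omega))).trans hB
      refine (run_carry_overflow (by simp [carry_count_word, hd])
        (by simpa [length_word] using hs)).trans ?_
      rw [carry_count_word, length_word, hsz]
      set u := N.word (Nat.size i) (i + 1) 0 with hu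
      have hul : u.length = Nat.size i := length_word _ _ _
      have hue : u ++ [(true, 0)] = N.word (Nat.size i + 1) (i + 1) 0 := by
        rw [hu, hi', word_two_pow_append]
      -- This is the only step that writes a cell on a blank, so neither `step_cell` nor
      -- `step_blank` applies.
      have h₂ : N.machine.BoundedStep x B
          (N.cfg (.carry .count) (i + 1) u (Nat.size i + 1) [])
          (N.cfg .count (i + 1) (u ++ [(true, 0)]) (Nat.size i) []) := by
        refine ⟨⟨act .count (some (true, 0)) .stay .left none, ?_, ?_⟩, fun _ => ?_⟩
        · have : N.delta (.carry .count) (readInput x (i + 1))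
              (N.tape u ((Nat.size i + 1 : ℕ) : ℤ)) =
              some (act .count (some (true, 0)) .stay .left none) := by
            rw [← hul, tape_end]; rfl
          exact this
        · have := tape_extend u (true, 0)
          rw [hul] at this
          simp only [Machine.Cfg.apply, cfg, act, Move.input, Move.work, ← this]
          simp
        · simp [cfg]; omega
      refine Relation.ReflTransGen.head h₂ ?_
      rw [hue]
      exact run_return (fun c => rfl) (by rw [length_word]; omega) (by omega)
    · rw [size_succ_of_not_dvd hd]
      have := run_carry_done (N := N) (x := x) (i := i + 1) (o := []) (B := B) (k := .count)
        (u := N.word (Nat.size i) i 0) (by simp [carry_count_word, hd])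
        (by simpa [length_word] using hs)
      simpa [carry_count_word, Op.done] using this

/-- The words before the number `t` are processed. -/
theorem run_words (hB : len x + 1 ≤ B) {t : ℕ} (ht : t < (N.m + 1) ^ len x) :
    N.Run x B (N.cfg .loop i (N.word (len x) i 0) 0 o)
      (N.cfg .loop i (N.word (len x) i t) 0 (o ++ (List.range t).flatMap fun t =>
        N.wordOut (readInput x i) (N.word (len x) i t))) := by
  induction t with
  | zero => simpa using Relation.ReflTransGen.refl
  | succ t ih =>
    refine (ih (by omega)).trans ((run_word _ rfl (by rwa [length_word])).trans ?_)
    have hd : ¬ (N.m + 1) ^ len x ∣ t + 1 := fun h =>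
      absurd (Nat.le_of_dvd (Nat.succ_pos t) h) (by omega)
    have := run_carry_done (N := N) (x := x) (i := i) (B := B) (k := .odometer)
      (o := o ++ (List.range (t + 1)).flatMap fun t =>
        N.wordOut (readInput x i) (N.word (len x) i t))
      (u := N.word (len x) i t) (by simp [carry_odometer_word, hd]) (by rwa [length_word])
    simpa [carry_odometer_word, Op.done, List.range_succ] using this

/-- All words are processed for the position `i`. -/
theorem run_position (hB : len x + 1 ≤ B) :
    N.Run x B (N.cfg .loop i (N.word (len x) i 0) 0 o)
      (N.cfg .borrow i (N.word (len x) i 0) 0 (o ++ N.posOut x i)) := by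
  obtain ⟨t, ht⟩ : ∃ t, (N.m + 1) ^ len x = t + 1 :=
    ⟨_, (Nat.succ_pred_eq_of_pos (by positivity)).symm⟩
  -- The last word is treated separately, because after it the odometer overflows and the machine
  -- passes to the next position.
  refine (run_words hB (t := t) (by omega)).trans
    ((run_word _ rfl (by rwa [length_word])).trans ?_)
  have h₁ := run_carry_overflow (N := N) (x := x) (i := i) (B := B) (k := .odometer)
    (o := o ++ N.posOut x i)
    (u := N.word (len x) i t) (by simp [carry_odometer_word, ht]) (by rwa [length_word])
  rw [carry_odometer_word, ← ht, word_pow, length_word] at h₁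
  have h₂ := step_blank (x := x) (i := i) (i' := i) (o := o ++ N.posOut x i) (B := B)
    (u := N.word (len x) i 0) (p := len x + 1) (p' := len x)
    (st := .carry .odometer) (st' := .borrow) (mi := .stay) (mw := .left) (ob := none)
    (by have := tape_end (N.word (len x) i 0); rwa [length_word] at this)
    rfl (by simp [Move.work]) rfl (by omega)
  simp only [Option.toList_none, List.append_nil] at h₂
  have h₃ := Relation.ReflTransGen.trans h₁ (Relation.ReflTransGen.head h₂
    (run_return (fun c => rfl) (by rw [length_word]) (by omega)))
  convert h₃ using 2
  simp [posOut, ht, List.range_succ]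

/-- All positions up to `i` are processed. -/
theorem run_positions (hB : len x + 1 ≤ B) (hi : i ≤ x.length + 1) :
    N.Run x B (N.cfg .loop i (N.word (len x) i 0) 0 o)
      (N.cfg .borrow 0 (N.word (len x) 0 0) 0
        (o ++ (List.range (i + 1)).reverse.flatMap (N.posOut x))) := by
  induction i generalizing o with
  | zero => simpa using run_position hB
  | succ i ih =>
    have h₁ := step_blank (x := x) (i := i + 1) (i' := i) (o := o ++ N.posOut x (i + 1)) (B := B)
      (u := N.word (len x) (i + 1) 0) (p := 0) (p' := 1)
      (st := .borrow) (st' := .carry .borrow) (mi := .left) (mw := .right) (ob := none)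
      (tape_zero _) (by
        have := readInput_succ_ne_leftEnd (x := x) (i := i)
        cases h : readInput x (i + 1) <;> simp_all [delta]) (by simp [Move.work])
      (by simp [Move.input]) (by omega)
    -- The position is positive and below `2 ^ len x`, so the borrow stops inside the word.
    have hd : ¬ 2 ^ len x ∣ i + 1 := fun h => by
      have h₂ := Nat.le_of_dvd (Nat.succ_pos i) h
      have h₃ : x.length + 1 < 2 ^ len x := Nat.lt_size_self _
      omega
    have h₂ := run_carry_done (N := N) (x := x) (i := i) (o := o ++ N.posOut x (i + 1)) (B := B)
      (k := .borrow) (u := N.word (len x) (i + 1) 0) (by simp [carry_borrow_word, hd])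
      (by rwa [length_word])
    simp only [Option.toList_none, List.append_nil] at h₁
    simp only [carry_borrow_word, Op.done] at h₂
    refine (run_position hB).trans (Relation.ReflTransGen.head h₁ (h₂.trans ?_))
    rw [List.range_succ]
    simpa using ih (o := o ++ N.posOut x (i + 1)) (by omega)

theorem run_init (hB : len x + 1 ≤ B) :
    N.Run x B N.machine.init (N.cfg .borrow 0 (N.word (len x) 0 0) 0 (N.output x)) := by
  have h₁ := step_blank (x := x) (i := x.length + 1) (i' := x.length + 1) (o := []) (B := B)
    (u := N.word (len x) (x.length + 1) 0) (p := 0) (p' := 0)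
    (st := .count) (st' := .loop) (mi := .stay) (mw := .stay) (ob := none)
    (tape_zero _) (by simp [delta, readInput_length_succ]) (by simp [Move.work]) rfl (by omega)
  refine (run_count hB le_rfl).trans (Relation.ReflTransGen.head h₁ ?_)
  simpa [output] using run_positions (N := N) (o := []) hB le_rfl

theorem halts (c : N.machine.Cfg) :
    ¬ N.machine.Step x (N.cfg .borrow 0 (N.word (len x) 0 0) 0 o) c := by
  rintro ⟨a, ha, -⟩
  have ha : N.delta .borrow (readInput x 0) (N.tape (N.word (len x) 0 0) ((0 : ℕ) : ℤ)) = some a :=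
    ha
  rw [Nat.cast_zero, tape_zero] at ha
  cases ha

/-- From `n < 2 ^ (log n + 1)` one gets `n + 1 < 2 ^ (log n + 2)`; the head also visits the blank
after the word, which gives `log n + 3 ≤ 3 * (log n + 1)`. -/
theorem len_add_one_le (x : List α) : len x + 1 ≤ 3 * (Nat.log 2 x.length + 1) := by
  have : len x ≤ Nat.log 2 x.length + 2 := by
    refine Nat.size_le.2 ?_
    have := Nat.lt_pow_succ_log_self (b := 2) (by norm_num) x.length
    rw [pow_succ]
    omega
  omega

theorem logSpaceComputable_output (N : Enumerator α β) : LogSpaceComputable N.output :=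
  ⟨N.machine, N.machine_isDeterministic,
    ⟨3, fun x _ hc => Machine.head_le_of_halting_run N.machine_isDeterministic
      (run_init (len_add_one_le x)) halts hc⟩,
    fun _ => ⟨_, Machine.reaches_of_boundedRun (run_init le_rfl), halts, rfl⟩⟩

/-- The output lists the codes of the values of `g` at the accepted words. -/
theorem exists_output_eq_flatMap {γ : Type} (e : γ → List β) (g : List N.Cell → γ)
    (hg : ∀ u, N.prog.flatMap (N.itemOut u) = e (g u)) (x : List α) :
    ∃ L : List γ, N.output x = L.flatMap e ∧ ∀ a, a ∈ L ↔
      ∃ i ≤ x.length + 1, ∃ w : Fin (len x) → Fin (N.m + 1),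
        N.Accepted (readInput x i) (List.ofFn fun j => (i.testBit j, w j)) ∧
          a = g (List.ofFn fun j => (i.testBit j, w j)) := by
  refine ⟨(List.range (x.length + 2)).reverse.flatMap fun i =>
    (List.range ((N.m + 1) ^ len x)).flatMap fun t =>
      if N.Accepted (readInput x i) (N.word (len x) i t) then [g (N.word (len x) i t)] else [],
    ?_, fun a => ?_⟩
  · rw [output, List.flatMap_assoc]
    congr 1
    funext i
    rw [posOut, List.flatMap_assoc]
    congr 1
    funext t
    unfold wordOut
    split_ifs <;> simp [hg]
  · simp only [List.mem_flatMap, List.mem_reverse, List.mem_range]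
    constructor
    · rintro ⟨i, hi, t, -, h⟩
      obtain ⟨w, hw⟩ := exists_word_eq (N := N) (len x) t
      refine ⟨i, by omega, w, ?_⟩
      rw [hw] at h
      split_ifs at h with h'
      · exact ⟨h', by simpa using h⟩
      · simp at h
    · rintro ⟨i, hi, w, h, ha⟩
      obtain ⟨t, ht, hw⟩ := exists_eq_word (N := N) (len x) w
      exact ⟨i, by omega, t, ht, by rw [hw, if_pos h]; simpa using ha⟩

end Enumerator

end LogSpace

/-! ### Censors as sets of edges without dead ends. -/

namespace CQE

/-- The fact that the edge from `a` to `b` is present. -/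
def edge (a b : Name) : Fact := .role [] a b

/-- The dependency `K R(x,y) → K ∃z R(y,z)`. -/
def succED : ED where
  body :=
    { atoms := {.role [] (.var 0) (.var 1)}
      nonempty := by simp
      exVars := ∅
      exVars_subset := by simp }
  head := some
    { atoms := {.role [] (.var 1) (.var 2)}
      nonempty := by simp
      exVars := {2}
      exVars_subset := by simp [Atom.args] }
  free_subset := by
    rintro q hq x ⟨⟨a, ha, hx⟩, hx'⟩
    obtain rfl := Option.some.inj hq
    simp only [Finset.mem_singleton] at ha
    subst ha
    simp only [Atom.args, Set.mem_insert_iff, Set.mem_singleton_iff, Term.var.injEq] at hx hx'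
    refine ⟨⟨_, Finset.mem_singleton_self _, ?_⟩, by simp⟩
    simp only [Atom.args, Set.mem_insert_iff, Set.mem_singleton_iff, Term.var.injEq]
    tauto

/-- The query `∃x,y R(x,y)`. -/
def edgeQuery : BUCQ where
  disjuncts := {
    { atoms := {.role [] (.var 0) (.var 1)}
      nonempty := by simp
      exVars := {0, 1}
      exVars_subset := by simp [Atom.args] }}
  closed := by
    intro q hq
    rw [Finset.mem_singleton] at hq
    subst hq
    ext x
    simp only [CQ.freeVars, CQ.vars, Finset.mem_singleton, exists_eq_left, Atom.args,
      Set.mem_sdiff, Set.mem_ofPred_eq, Set.mem_insert_iff, Set.mem_singleton_iff, Term.var.injEq,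
      Set.mem_empty_iff_false]
    tauto

/-- The interpretation on the set of names in which exactly the facts of `F` are true. -/
def canonical (F : Set Fact) : Interp where
  Dom := Name
  ind := id
  concept := fun A => {a | .concept A a ∈ F}
  role := fun R => {p | .role R p.1 p.2 ∈ F}

theorem canonical_satFact {F : Set Fact} {f : Fact} : (canonical F).SatFact f ↔ f ∈ F := by
  cases f <;> rfl

theorem canonical_isModel (F : Set Fact) : (canonical F).IsModel ∅ F :=
  ⟨by simp, fun _ h => canonical_satFact.2 h⟩

theorem closure_empty (F : Set Fact) : closure ∅ F = F :=
  Set.Subset.antisymm (fun _ h => canonical_satFact.1 (h _ (canonical_isModel F)))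
    fun _ h _ hI => hI.2 _ h

/-- Entailment is tested in the canonical model, where exactly the facts of `F` hold and all
elements are names; the existential witness of the head is therefore a name as well. -/
theorem satED_succED {F : Set Fact} :
    SatED ∅ F succED ↔ ∀ a b, edge a b ∈ F → ∃ d, edge b d ∈ F := by
  constructor
  · intro h a b hab
    have := h (fun x => if x = 0 then a else b) (fun I hI =>
      ⟨_, fun _ _ => rfl, fun f hf => by
        obtain rfl := Finset.mem_singleton.1 hf
        exact hI.2 _ hab⟩) (canonical F) (canonical_isModel F)
    obtain ⟨v, hv, hF⟩ := this
    have hF := hF _ (Finset.mem_singleton_self _)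
    have h1 : v 1 = b := hv 1 (by simp)
    refine ⟨v 2, ?_⟩
    have hF : edge (v 1) (v 2) ∈ F := hF
    rwa [h1] at hF
  · intro h s hs I hI
    obtain ⟨v, hv, hF⟩ := hs (canonical F) (canonical_isModel F)
    have hF : edge (v 0) (v 1) ∈ F := hF _ (Finset.mem_singleton_self _)
    have h1 : v 1 = s 1 := hv 1 (by simp [succED])
    rw [h1] at hF
    obtain ⟨d, hd⟩ := h _ _ hF
    refine ⟨fun x => if x = 2 then I.ind d else I.ind (s x), fun x hx => ?_, fun f hf => ?_⟩
    · have : x ≠ 2 := hx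
      simp [this]
    · obtain rfl := Finset.mem_singleton.1 hf
      exact hI.2 _ hd

theorem entailsBUCQ_edgeQuery {F : Set Fact} :
    EntailsBUCQ ∅ F edgeQuery ↔ ∃ a b, edge a b ∈ F := by
  constructor
  · intro h
    obtain ⟨q, hq, v, v', -, hF⟩ := h (canonical F) (canonical_isModel F)
    obtain rfl := Finset.mem_singleton.1 hq
    exact ⟨v' 0, v' 1, hF _ (Finset.mem_singleton_self _)⟩
  · rintro ⟨a, b, hab⟩ I hI
    refine ⟨_, Finset.mem_singleton_self _, fun x => if x = 0 then I.ind a else I.ind b,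
      _, fun _ _ => rfl, fun f hf => ?_⟩
    obtain rfl := Finset.mem_singleton.1 hf
    exact hI.2 _ hab

/-- For the dependency `succED`, the largest censor is the union of all censors, and the query is
entailed if and only if some censor has an edge. -/
theorem igaEntails_edgeQuery {E : Inst} (hT : E.tbox = ∅) (hP : E.policy = {succED}) :
    E.IGAEntails edgeQuery ↔ ∃ C ⊆ (E.abox : Set Fact),
      (∃ a b, edge a b ∈ C) ∧ ∀ a b, edge a b ∈ C → ∃ d, edge b d ∈ C := by
  have hcensor : ∀ C, E.IsCensor C ↔ C ⊆ (E.abox : Set Fact) ∧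
      ∀ a b, edge a b ∈ C → ∃ d, edge b d ∈ C := by
    intro C
    simp [Inst.IsCensor, hT, hP, closure_empty, satED_succED]
  have hunion : ∀ S : Set (Set Fact), (∀ C ∈ S, E.IsCensor C) → E.IsCensor (⋃₀ S) := by
    intro S hS
    rw [hcensor]
    refine ⟨Set.sUnion_subset fun C hC => ((hcensor C).1 (hS C hC)).1, ?_⟩
    rintro a b ⟨C, hC, hab⟩
    obtain ⟨d, hd⟩ := ((hcensor C).1 (hS C hC)).2 a b hab
    exact ⟨d, C, hC, hd⟩
  have hmax : E.IsOptimalCensor (⋃₀ {C | E.IsCensor C}) :=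
    ⟨hunion _ fun C hC => hC, fun ⟨C, hC, hlt⟩ => hlt.not_subset (Set.subset_sUnion_of_mem hC)⟩
  rw [Inst.IGAEntails, hT, entailsBUCQ_edgeQuery]
  constructor
  · rintro ⟨a, b, hab⟩
    obtain ⟨C, hC, hab⟩ := hab _ hmax
    obtain ⟨h₁, h₂⟩ := (hcensor C).1 hC
    exact ⟨C, h₁, ⟨a, b, hab⟩, h₂⟩
  · rintro ⟨C, hCA, ⟨a, b, hab⟩, hC⟩
    have hC : E.IsCensor C := (hcensor C).2 ⟨hCA, hC⟩
    -- An optimal censor absorbs `C`, since its union with `C` is again a censor.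
    refine ⟨a, b, fun C' hC' => ?_⟩
    have hCC : E.IsCensor (C ∪ C') := by
      have := hunion {C, C'} (by rintro _ (rfl | rfl); exacts [hC, hC'.1])
      rwa [Set.sUnion_pair] at this
    by_contra hn
    exact hC'.2 ⟨_, hCC, Set.subset_union_right, fun h => hn (h (Or.inl hab))⟩

/-! ### Unique decoding -/

/-- Delimiters are not bits, so the first delimiter marks the end of the name. -/
theorem map_bit_append_inj {c c' : Sym} (hc : ∀ b, c ≠ .bit b) (hc' : ∀ b, c' ≠ .bit b)
    {a a' : List Bool} {s s' : List Sym}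
    (h : a.map Sym.bit ++ c :: s = a'.map Sym.bit ++ c' :: s') : a = a' ∧ c = c' ∧ s = s' := by
  induction a generalizing a' with
  | nil =>
    cases a' with
    | nil => simpa using h
    | cons b a' => exact absurd (List.cons.inj h).1 (hc b)
  | cons b a ih =>
    cases a' with
    | nil => exact absurd (List.cons.inj h).1.symm (hc' b)
    | cons b' a' =>
      obtain ⟨h₁, h₂⟩ := List.cons.inj h
      obtain ⟨rfl, h₃⟩ := ih h₂
      exact ⟨by rw [Sym.bit.inj h₁], h₃⟩

theorem encodeFact_append_inj {f f' : Fact} {s s' : List Sym}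
    (h : encodeFact f ++ s = encodeFact f' ++ s') : f = f' ∧ s = s' := by
  cases f <;> cases f' <;> simp only [encodeFact, List.append_assoc, List.singleton_append] at h
  all_goals
    obtain ⟨rfl, -, h⟩ := map_bit_append_inj (by simp) (by simp) h
    obtain ⟨rfl, h₁, h⟩ := map_bit_append_inj (by simp) (by simp) h
  · exact ⟨rfl, h⟩
  · cases h₁
  · cases h₁
  · obtain ⟨rfl, -, h⟩ := map_bit_append_inj (by simp) (by simp) h
    exact ⟨rfl, h⟩

theorem encodeFact_ne_nil (f : Fact) : encodeFact f ≠ [] := by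
  cases f <;> simp [encodeFact]

/-- The codes of facts are nonempty and self-delimiting. Injectivity is needed because membership in
`IGAEnt` allows any ABox that the string encodes. -/
theorem flatMap_encodeFact_injective :
    Function.Injective fun l : List Fact => l.flatMap encodeFact := by
  intro l
  induction l with
  | nil =>
    rintro (_ | ⟨f, l'⟩) h
    · rfl
    · simp only [List.flatMap_nil, List.flatMap_cons] at h
      exact absurd (List.append_eq_nil_iff.1 h.symm).1 (encodeFact_ne_nil f)
  | cons f l ih =>
    rintro (_ | ⟨f', l'⟩) h
    · simp only [List.flatMap_nil, List.flatMap_cons] at h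
      exact absurd (List.append_eq_nil_iff.1 h).1 (encodeFact_ne_nil f)
    · simp only [List.flatMap_cons] at h
      obtain ⟨rfl, hl⟩ := encodeFact_append_inj h
      rw [@ih l' hl]

/-- IGA-entailment of the query for an ABox that is given as a list of facts. -/
theorem flatMap_encodeFact_mem_igaEnt (l : List Fact) :
    l.flatMap encodeFact ∈ IGAEnt ∅ {succED} edgeQuery ↔ ∃ C : Set Fact, (∀ f ∈ C, f ∈ l) ∧
      (∃ a b, edge a b ∈ C) ∧ ∀ a b, edge a b ∈ C → ∃ d, edge b d ∈ C := by
  constructor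
  · rintro ⟨E, hT, hP, ⟨l', hl', h⟩, hE⟩
    obtain rfl := flatMap_encodeFact_injective h
    obtain ⟨C, hC, h⟩ := (igaEntails_edgeQuery hT hP).1 hE
    exact ⟨C, fun f hf => (hl' f).2 (hC hf), h⟩
  · rintro ⟨C, hC, h⟩
    refine ⟨⟨∅, {succED}, l.toFinset, ⟨_, canonical_isModel _⟩⟩, rfl, rfl, ⟨l, by simp, rfl⟩,
      (igaEntails_edgeQuery rfl rfl).2 ⟨C, fun f hf => ?_, h⟩⟩
    simpa using hC f hf

end CQE

/-! ### Shortest paths, tilings checked by automata, and names of words. -/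

namespace LogSpace

/-- A path of minimal length visits no point twice. -/
theorem exists_path_lt_card {X : Type} [Fintype X] {r : X → X → Prop} {a b : X}
    (h : Relation.ReflTransGen r a b) :
    ∃ n < Fintype.card X, ∃ p : ℕ → X, p 0 = a ∧ p n = b ∧ ∀ j < n, r (p j) (p (j + 1)) := by
  classical
  have hex : ∃ n, ∃ p : ℕ → X, p 0 = a ∧ p n = b ∧ ∀ j < n, r (p j) (p (j + 1)) := by
    induction h with
    | refl => exact ⟨0, fun _ => a, rfl, rfl, by simp⟩
    | @tail c d _ hcd ih =>
      obtain ⟨n, p, h0, hn, hp⟩ := ih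
      refine ⟨n + 1, fun j => if j ≤ n then p j else d, by simpa using h0, by simp, fun j hj => ?_⟩
      rcases Nat.lt_succ_iff_lt_or_eq.1 hj with hj | rfl
      · simpa [hj.le, Nat.succ_le_of_lt hj] using hp j hj
      · simpa [hn] using hcd
  obtain ⟨p, h0, hn, hp⟩ := Nat.find_spec hex
  refine ⟨Nat.find hex, ?_, p, h0, hn, hp⟩
  set n := Nat.find hex with hn_def
  suffices hinj : Function.Injective fun j : Fin (n + 1) => p j by
    simpa using Fintype.card_le_of_injective _ hinj
  have key : ∀ i j, i < j → j ≤ n → p i ≠ p j := by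
    intro i j hij hj e
    -- If `p i = p j`, the part of the path between `i` and `j` can be cut out, against minimality.
    refine Nat.find_min hex (m := n - (j - i)) (by omega)
      ⟨fun l => if l ≤ i then p l else p (l + (j - i)), by simpa using h0, ?_, fun l hl => ?_⟩
    · by_cases h : n - (j - i) ≤ i
      · have : n - (j - i) = i := by omega
        have hjn : j = n := by omega
        simp only [this, le_refl, if_true]
        rw [e, hjn, hn]
      · simp only [h, if_false]
        rw [← hn]
        congr 1
        omega
    · rcases lt_trichotomy l i with h | rfl | h
      · simpa [h.le, Nat.succ_le_of_lt h] using hp l (by omega)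
      · have := hp j (by omega)
        rw [← e] at this
        simpa [show l + 1 + (j - l) = j + 1 by omega] using this
      · simpa [show ¬ l ≤ i by omega, show ¬ l + 1 ≤ i by omega,
          show l + 1 + (j - i) = l + (j - i) + 1 by omega] using hp (l + (j - i)) (by omega)
  intro i j e
  rcases lt_trichotomy i j with h | h | h
  · exact absurd e (key i j h (by omega))
  · exact h
  · exact absurd e.symm (key j i h (by omega))

theorem finite_inSym (α : Type) [Finite α] : Finite (InSym α) :=
  Finite.of_injective (β := Option (Option α)) (fun s => match s with
    | .leftEnd => none
    | .rightEnd => some none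
    | .letter a => some (some a))
    (by rintro (_ | _ | _) (_ | _ | _) h <;> simp_all)

/-- A finite tiling system that describes words by conditions on the first cell, on adjacent cells
and on the last cell; the latter may depend on the first cell. -/
structure Tiling (α C : Type) : Type where
  first : InSym α → C → Prop
  adj : C → C → C → Prop
  last : C → C → Prop

namespace Tiling

variable {α C : Type} (T : Tiling α C)

/-- The nonempty word `u` satisfies the conditions. -/
def Valid (s : InSym α) {l : ℕ} (u : Fin l → C) : Prop :=
  ∃ h : 0 < l, T.first s (u ⟨0, h⟩) ∧
    (∀ j (hj : j + 1 < l), T.adj (u ⟨0, h⟩) (u ⟨j, by omega⟩) (u ⟨j + 1, hj⟩)) ∧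
    T.last (u ⟨0, h⟩) (u ⟨l - 1, by omega⟩)

open Classical in
/-- Transitions of an automaton that remembers the first and the previous cell. -/
noncomputable def autStep : Option (InSym α ⊕ C × C) → C → Option (InSym α ⊕ C × C)
  | none, _ => none
  | some (.inl s), c => if T.first s c then some (.inr (c, c)) else none
  | some (.inr (f, p)), c => if T.adj f p c then some (.inr (f, c)) else none

open Classical in
noncomputable def autAcc : Option (InSym α ⊕ C × C) → Bool
  | some (.inr (f, p)) => decide (T.last f p)
  | _ => false

theorem foldl_none (r : List C) : r.foldl T.autStep none = none := by
  induction r with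
  | nil => rfl
  | cons c r ih => simpa [autStep] using ih

open Classical in
-- The automaton survives exactly as long as all adjacency conditions hold; its state then records
-- the first and the latest cell, all that the condition on the last cell needs.
theorem foldl_inr (f p : C) (r : List C) :
    r.foldl T.autStep (some (.inr (f, p))) = if List.IsChain (T.adj f) (p :: r) then
      some (.inr (f, (p :: r).getLast (List.cons_ne_nil _ _))) else none := by
  induction r generalizing p with
  | nil => simp
  | cons c r ih =>
    by_cases h : T.adj f p c
    · simp [autStep, h, ih]
    · simp [autStep, h, foldl_none]

theorem autAcc_foldl (s : InSym α) {l : ℕ} (u : Fin l → C) :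
    T.autAcc ((List.ofFn u).foldl T.autStep (some (.inl s))) = true ↔ T.Valid s u := by
  rcases l with _ | l
  · simp [autAcc, Valid]
  · have hchain : List.IsChain (T.adj (u 0)) (u 0 :: List.ofFn fun j => u (Fin.succ j)) ↔
        ∀ j (hj : j + 1 < l + 1), T.adj (u 0) (u ⟨j, by omega⟩) (u ⟨j + 1, hj⟩) := by
      rw [← List.ofFn_succ, List.isChain_iff_getElem]
      simp only [List.length_ofFn, List.getElem_ofFn]
    have hlast : (u 0 :: List.ofFn fun j => u (Fin.succ j)).getLast (List.cons_ne_nil _ _) =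
        u ⟨l, by omega⟩ := by
      simp only [← List.ofFn_succ]
      rw [List.getLast_ofFn]
      rfl
    rw [List.ofFn_succ, List.foldl_cons]
    by_cases h : T.first s (u 0)
    · simp only [autStep, h, if_true]
      rw [foldl_inr, hlast]
      split_ifs with h' <;> rw [hchain] at h'
      · simp only [autAcc, decide_eq_true_eq]
        exact ⟨fun h'' => ⟨Nat.succ_pos l, h, h', h''⟩, fun h'' => h''.2.2.2⟩
      · simp only [autAcc, Bool.false_eq_true, false_iff]
        exact fun h'' => h' h''.2.2.1
    · simp only [autStep, h, if_false, foldl_none, autAcc, Bool.false_eq_true, false_iff]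
      exact fun h'' => h h''.2.1

end Tiling

open Classical in
/-- The name of a word over a finite alphabet. -/
noncomputable def wordName {V : Type} [Fintype V] {l : ℕ} (v : Fin l → V) : CQE.Name :=
  Finset.univ.toList.flatMap fun a : V => List.ofFn fun j => decide (v j = a)

/-- A name consists of one block per letter, each of the same length `l`; so the blocks can be
separated, and the block of a letter shows where it occurs. -/
theorem wordName_injective {V : Type} [Fintype V] {l : ℕ} :
    Function.Injective (wordName : (Fin l → V) → CQE.Name) := by
  classical
  intro v v' h
  have key : ∀ L : List V, (L.flatMap fun a : V => List.ofFn fun j => decide (v j = a)) =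
      (L.flatMap fun a : V => List.ofFn fun j => decide (v' j = a)) →
      ∀ a ∈ L, ∀ j, v j = a ↔ v' j = a := by
    intro L
    induction L with
    | nil => simp
    | cons b L ih =>
      intro h
      simp only [List.flatMap_cons] at h
      obtain ⟨h₁, h₂⟩ := List.append_inj h (by simp)
      intro a ha j
      rcases List.mem_cons.1 ha with rfl | ha
      · simpa using congrFun (List.ofFn_injective h₁) j
      · exact ih h₂ a ha j
  funext j
  refine ((key Finset.univ.toList ?_ (v j) (by simp) j).1 rfl).symm
  unfold wordName at h
  convert h

open CQE in
/-- The edges between the source words and the target words of the valid words can be listed in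
logarithmic space. -/
theorem exists_logSpaceComputable_edges {α C V : Type} [Finite α] [Finite C] [Nonempty C]
    [Fintype V] (T : Tiling α (Bool × C)) (src tgt : Bool × C → V) :
    ∃ f : List α → List Sym, LogSpaceComputable f ∧ ∀ x, ∃ L : List Fact,
      f x = L.flatMap encodeFact ∧ ∀ a, a ∈ L ↔ ∃ i ≤ x.length + 1,
        ∃ w : Fin (Enumerator.len x) → C, T.Valid (readInput x i) (fun j => (i.testBit j, w j)) ∧
          a = edge (wordName fun j => src (i.testBit j, w j))
            (wordName fun j => tgt (i.testBit j, w j)) := by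
  classical
  have := finite_inSym α
  obtain ⟨m, dec, hdec⟩ : ∃ m, ∃ dec : Fin (m + 1) → C, Function.Surjective dec := by
    obtain ⟨n, ⟨e⟩⟩ := Finite.exists_equiv_fin C
    rcases n with _ | m
    · exact (e (Classical.arbitrary C)).elim0
    · exact ⟨m, e.symm, e.symm.surjective⟩
  let d : Bool × Fin (m + 1) → Bool × C := fun c => (c.1, dec c.2)
  -- One sweep over the word per letter `a`, printing one bit per cell: this is the order of the
  -- bits in `wordName`.
  let bits (h : Bool × C → V) : List (Sym ⊕ (Bool × Fin (m + 1) → Sym)) :=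
    Finset.univ.toList.map fun a => .inr fun c => .bit (decide (h (d c) = a))
  let N : Enumerator α Sym :=
    { m := m
      D := Option (InSym α ⊕ (Bool × C) × (Bool × C))
      finD := inferInstance
      start := fun s => some (.inl s)
      step := fun p c => T.autStep p (d c)
      acc := T.autAcc
      prog := [.inl .lpar] ++ bits src ++ [.inl .comma] ++ bits tgt ++ [.inl .rpar] }
  let name (h : Bool × C → V) (u : List N.Cell) : Name :=
    Finset.univ.toList.flatMap fun a => u.map fun c => decide (h (d c) = a)
  have hbits : ∀ h u, (bits h).flatMap (N.itemOut u) = (name h u).map Sym.bit := by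
    intro h u
    simp only [bits, name, List.flatMap_map, List.map_flatMap, Enumerator.itemOut, List.map_map]
    rfl
  have hname : ∀ (h : Bool × C → V) (l : ℕ) (u : Fin l → N.Cell),
      name h (List.ofFn u) = wordName fun j => h (d (u j)) := by
    intro h l u
    simp only [name, wordName, List.map_ofFn]
    rfl
  have hacc : ∀ (s : InSym α) (l : ℕ) (u : Fin l → N.Cell),
      N.Accepted s (List.ofFn u) = true ↔ T.Valid s fun j => d (u j) := by
    intro s l u
    rw [← T.autAcc_foldl]
    have : (List.ofFn fun j => d (u j)) = (List.ofFn u).map d := by simp [List.map_ofFn]; rfl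
    rw [this, List.foldl_map]
    rfl
  refine ⟨N.output, N.logSpaceComputable_output, fun x => ?_⟩
  obtain ⟨L, hL, hmem⟩ := Enumerator.exists_output_eq_flatMap (N := N) encodeFact
    (fun u => edge (name src u) (name tgt u)) (fun u => by
      simp only [N, List.flatMap_append, hbits]
      simp [edge, encodeFact, Enumerator.itemOut]) x
  refine ⟨L, hL, fun a => (hmem a).trans ?_⟩
  constructor
  · rintro ⟨i, hi, w, h, rfl⟩
    exact ⟨i, hi, fun j => dec (w j), (hacc _ _ _).1 h, by rw [hname, hname]⟩
  · rintro ⟨i, hi, w, h, rfl⟩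
    choose w' hw' using fun j => hdec (w j)
    obtain rfl : (fun j => dec (w' j)) = w := funext hw'
    exact ⟨i, hi, w', (hacc _ _ _).2 h, by rw [hname, hname]⟩

end LogSpace

namespace LogSpace

/-! ### Positional notation -/

/-- The number with the digits `d` to the base `b`, the least significant digit first. -/
def value (b : ℕ) {l : ℕ} (d : Fin l → ℕ) : ℕ := ∑ j, d j * b ^ (j : ℕ)

theorem value_succ (b : ℕ) {l : ℕ} (d : Fin (l + 1) → ℕ) :
    value b d = d 0 + b * value b fun j => d j.succ := by
  simp only [value, Fin.sum_univ_succ, Fin.val_zero, pow_zero, mul_one, Fin.val_succ, pow_succ,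
    Finset.mul_sum]
  congr 1
  exact Finset.sum_congr rfl fun j _ => by ring

theorem value_testBit {l i : ℕ} (hi : i < 2 ^ l) :
    value 2 (fun j : Fin l => (i.testBit j).toNat) = i := by
  induction l generalizing i with
  | zero =>
    have : i = 0 := by simpa using hi
    simp [value, this]
  | succ l ih =>
    rw [value_succ]
    have h := ih (i := i / 2) (by rw [pow_succ] at hi; omega)
    simp only [Fin.val_succ, Nat.testBit_succ, h, Fin.val_zero, Nat.testBit_zero]
    rcases Nat.mod_two_eq_zero_or_one i with h | h <;> simp [h] <;> omega

theorem testBit_value {l : ℕ} (d : Fin l → Bool) (j : Fin l) :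
    (value 2 fun j => (d j).toNat).testBit j = d j := by
  induction l with
  | zero => exact j.elim0
  | succ l ih =>
    rw [value_succ]
    refine Fin.cases ?_ (fun j => ?_) j
    · cases h : d 0 <;> simp [Nat.testBit_zero]
    · have h₁ : ((d 0).toNat + 2 * value 2 fun j => (d j.succ).toNat) / 2 =
          value 2 fun j => (d j.succ).toNat := by
        cases d 0
        all_goals simp
        all_goals omega
      rw [Fin.val_succ, Nat.testBit_succ, h₁]
      exact ih (fun j => d j.succ) j

/-- A digitwise addition with the carries `κ` that does not overflow. -/
def Adds (b : ℕ) {l : ℕ} (d d' κ : Fin l → ℕ) : Prop :=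
  (∀ j (hj : j + 1 < l),
    d ⟨j, by omega⟩ + κ ⟨j, by omega⟩ = d' ⟨j, by omega⟩ + b * κ ⟨j + 1, hj⟩) ∧
  ∀ h : 0 < l, d ⟨l - 1, by omega⟩ + κ ⟨l - 1, by omega⟩ = d' ⟨l - 1, by omega⟩

theorem Adds.tail {b l : ℕ} {d d' κ : Fin (l + 2) → ℕ} (h : Adds b d d' κ) :
    Adds b (fun j => d j.succ) (fun j => d' j.succ) (fun j => κ j.succ) :=
  ⟨fun j hj => h.1 (j + 1) (by omega), fun _ => h.2 (by omega)⟩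

/-- The inner carries telescope, and the condition at the top digit excludes a carry out of the
word. -/
theorem Adds.value_eq {b l : ℕ} {d d' κ : Fin (l + 1) → ℕ} (h : Adds b d d' κ) :
    value b d + κ 0 = value b d' := by
  induction l with
  | zero => simpa [value] using h.2 (by omega)
  | succ l ih =>
    have h₁ : d 0 + κ 0 = d' 0 + b * κ (Fin.succ 0) := h.1 0 (by omega)
    have h₂ := ih h.tail
    rw [value_succ b d, value_succ b d', ← h₂, mul_add]
    omega

theorem exists_adds {b l : ℕ} {d d' : Fin (l + 1) → ℕ} (hd : ∀ j, d j < b)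
    (hd' : ∀ j, d' j < b) (k : Bool) (h : value b d + k.toNat = value b d') :
    ∃ κ : Fin (l + 1) → Bool, κ 0 = k ∧ Adds b d d' fun j => (κ j).toNat := by
  induction l generalizing k with
  | zero =>
    refine ⟨fun _ => k, rfl, fun j hj => by omega, fun _ => ?_⟩
    simpa [value] using h
  | succ l ih =>
    rw [value_succ b d, value_succ b d'] at h
    have h₀ := hd 0
    have h₀' := hd' 0
    have hk : k.toNat ≤ 1 := Bool.toNat_le k
    -- The equation modulo `b` determines the lowest digit. A carry arises only if `d 0 + k` reaches
    -- `b`, and then it equals `b`, so that `d' 0 = 0`.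
    obtain ⟨k', hk', hv⟩ : ∃ k' : Bool, d 0 + k.toNat = d' 0 + b * k'.toNat ∧
        (value b fun j => d j.succ) + k'.toNat = value b fun j => d' j.succ := by
      generalize value b (fun j => d j.succ) = X at h ⊢
      generalize value b (fun j => d' j.succ) = Y at h ⊢
      rcases lt_or_ge (d 0 + k.toNat) b with hlt | hge
      · have hm := congrArg (· % b) h
        have e₁ : d 0 + b * X + k.toNat = d 0 + k.toNat + b * X := by ring
        simp only [e₁, Nat.add_mul_mod_self_left, Nat.mod_eq_of_lt hlt, Nat.mod_eq_of_lt h₀'] at hm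
        refine ⟨false, by simpa using hm, ?_⟩
        have : b * X = b * Y := by omega
        simpa using Nat.eq_of_mul_eq_mul_left (by omega) this
      · have hb : d 0 + k.toNat = b := by omega
        have e₁ : d 0 + b * X + k.toNat = b * (X + 1) := by rw [mul_add]; omega
        have hm := congrArg (· % b) h
        simp only [e₁, Nat.add_mul_mod_self_left, Nat.mod_eq_of_lt h₀', Nat.mul_mod_right] at hm
        refine ⟨true, by simp; omega, ?_⟩
        rw [e₁, ← hm, zero_add] at h
        simpa using Nat.eq_of_mul_eq_mul_left (by omega) h
    obtain ⟨κ, hκ, hadd⟩ := ih (fun j => hd j.succ) (fun j => hd' j.succ) k' hv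
    refine ⟨Fin.cons k κ, rfl, fun j hj => ?_, fun _ => hadd.2 (by omega)⟩
    rcases j with _ | j
    · have : d 0 + k.toNat = d' 0 + b * (κ 0).toNat := by rw [hκ, hk']
      exact this
    · exact hadd.1 j (by omega)

/-! ### Words as circular tapes -/

section Circular

variable {k l : ℕ} [NeZero l] {X : Type}

/-- The cell in which the square `z` of a circular tape is stored. -/
def cellIdx (l : ℕ) [NeZero l] (z : ℤ) : Fin l :=
  ⟨(z % l).toNat, by
    have hl : (0 : ℤ) < l := by exact_mod_cast Nat.pos_of_ne_zero (NeZero.ne l)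
    have := Int.emod_lt_of_pos z hl
    have := Int.emod_nonneg z hl.ne'
    omega⟩

theorem cellIdx_val (z : ℤ) : ((cellIdx l z : ℕ) : ℤ) = z % l := by
  have hl : (l : ℤ) ≠ 0 := by exact_mod_cast NeZero.ne l
  simp [cellIdx, Int.emod_nonneg z hl]

/-- The symbol on the square `z` of the circular tape of length `k * l` that is stored in `l` cells
with `k` slots: the square `z` is in the cell `z mod l`, slot `z / l mod k`. -/
def onSquare (s : Fin l → ZMod k → X) (z : ℤ) : X := s (cellIdx l z) ((z / l : ℤ) : ZMod k)

theorem cellIdx_eq_zero_iff (z : ℤ) : cellIdx l z = 0 ↔ (l : ℤ) ∣ z := by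
  rw [Int.dvd_iff_emod_eq_zero, ← cellIdx_val, Fin.ext_iff]
  simp

/-- Neighbouring squares lie in neighbouring cells with the same slot, except at the seam, where the
last cell is followed by cell `0` with the next slot. -/
theorem cellIdx_add_one (z : ℤ) :
    (∃ h : (cellIdx l z : ℕ) + 1 < l, cellIdx l (z + 1) = ⟨cellIdx l z + 1, h⟩ ∧
      (z + 1) / l = z / l) ∨
    ((cellIdx l z : ℕ) = l - 1 ∧ cellIdx l (z + 1) = 0 ∧ (z + 1) / l = z / l + 1) := by
  have hl : (0 : ℤ) < l := by exact_mod_cast Nat.pos_of_ne_zero (NeZero.ne l)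
  have h₁ := cellIdx_val (l := l) z
  have h₂ := Int.mul_ediv_add_emod z l
  rcases Nat.lt_or_ge ((cellIdx l z : ℕ) + 1) l with h | h
  · left
    have e : z + 1 = (z % l + 1) + l * (z / l) := by linarith
    have hm : 0 ≤ z % l + 1 ∧ z % l + 1 < l := by omega
    refine ⟨h, Fin.ext ?_, ?_⟩
    · have h₃ := cellIdx_val (l := l) (z + 1)
      rw [e, Int.add_mul_emod_self_left, Int.emod_eq_of_lt hm.1 hm.2, ← e] at h₃
      simp only
      omega
    · rw [e, Int.add_mul_ediv_left _ _ hl.ne', Int.ediv_eq_zero_of_lt hm.1 hm.2, zero_add]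
  · right
    have hlt := (cellIdx l z).isLt
    have e : z + 1 = l * (z / l + 1) := by rw [mul_add]; omega
    refine ⟨by omega, (cellIdx_eq_zero_iff _).2 ⟨_, e⟩, ?_⟩
    rw [e, Int.mul_ediv_cancel_left _ hl.ne']

/-- The square stored in a given cell and slot. -/
def square (j : Fin l) (r : ZMod k) : ℤ := j + l * (r.val : ℤ)

theorem cellIdx_square (j : Fin l) (r : ZMod k) : cellIdx l (square j r) = j := by
  have h := cellIdx_val (l := l) (square j r)
  have hj : (j : ℤ) < l := by exact_mod_cast j.isLt
  rw [square, Int.add_mul_emod_self_left, Int.emod_eq_of_lt (by omega) hj] at h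
  exact Fin.ext (by exact_mod_cast h)

theorem square_ediv [NeZero k] (j : Fin l) (r : ZMod k) : ((square j r / l : ℤ) : ZMod k) = r := by
  have hl : (l : ℤ) ≠ 0 := by exact_mod_cast NeZero.ne l
  have hj : (j : ℤ) < l := by exact_mod_cast j.isLt
  rw [square, Int.add_mul_ediv_left _ _ hl, Int.ediv_eq_zero_of_lt (by omega) hj]
  simp

theorem onSquare_square [NeZero k] (s : Fin l → ZMod k → X) (j : Fin l) (r : ZMod k) :
    onSquare s (square j r) = s j r := by
  rw [onSquare, cellIdx_square, square_ediv]

/-- The tape has circumference `l * k`. -/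
theorem onSquare_add_mul (s : Fin l → ZMod k → X) (z t : ℤ) :
    onSquare s (z + l * (k * t)) = onSquare s z := by
  have hl : (l : ℤ) ≠ 0 := by exact_mod_cast NeZero.ne l
  have h : cellIdx l (z + l * (k * t)) = cellIdx l z := by
    ext
    simp [cellIdx]
  rw [onSquare, h, Int.add_mul_ediv_left _ _ hl]
  simp [onSquare]

theorem exists_square_eq [NeZero k] (z : ℤ) :
    ∃ t : ℤ, square (cellIdx l z) ((z / l : ℤ) : ZMod k) = z + l * (k * t) := by
  refine ⟨-(z / l / k), ?_⟩
  have h₁ := Int.mul_ediv_add_emod z l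
  have h₂ := Int.mul_ediv_add_emod (z / l) k
  rw [square, cellIdx_val, ZMod.val_intCast]
  linear_combination h₁ + l * h₂

/-- The circular tape with another symbol on the square `0`. -/
def overwrite (s : Fin l → ZMod k → X) (a : X) : Fin l → ZMod k → X :=
  fun j r => if j = 0 ∧ r = 0 then a else s j r

theorem onSquare_overwrite (s : Fin l → ZMod k → X) (a : X) (z : ℤ) :
    onSquare (overwrite s a) z = if (l * k : ℤ) ∣ z then a else onSquare s z := by
  have hl : (l : ℤ) ≠ 0 := by exact_mod_cast NeZero.ne l
  have : (cellIdx l z = 0 ∧ ((z / l : ℤ) : ZMod k) = 0) ↔ (l * k : ℤ) ∣ z := by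
    rw [cellIdx_eq_zero_iff, ZMod.intCast_zmod_eq_zero_iff_dvd]
    constructor
    · rintro ⟨⟨c, rfl⟩, h⟩
      rw [Int.mul_ediv_cancel_left _ hl] at h
      exact mul_dvd_mul_left _ h
    · rintro ⟨c, rfl⟩
      rw [mul_assoc, Int.mul_ediv_cancel_left _ hl]
      exact ⟨dvd_mul_right _ _, dvd_mul_right _ _⟩
  simp only [onSquare, overwrite, this]

/-- The cells `c`, `c'` of two tapes are followed by `d`, `d'`, and the first tape arises from the
second by the shift that corresponds to a movement of the head; `e` is the slot offset. -/
def Shifts (e : ZMod k) (mv : Move) (c c' d d' : ZMod k → X) : Prop :=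
  ∀ r, match mv with
    | .left => d (r + e) = c' r
    | .stay => c r = c' r
    | .right => c r = d' (r + e)

/-- By `cellIdx_add_one`, a shift by one square relates only adjacent cells with slot offset `0`,
and the last cell to cell `0` with slot offset `1`. So a global shift is a local condition of the
kind that a tiling can express. -/
theorem shifts_iff [NeZero k] (s s' : Fin l → ZMod k → X) (mv : Move) :
    ((∀ j (hj : j + 1 < l),
        Shifts 0 mv (s ⟨j, by omega⟩) (s' ⟨j, by omega⟩) (s ⟨j + 1, hj⟩) (s' ⟨j + 1, hj⟩)) ∧
      ∀ h : 0 < l, Shifts 1 mv (s ⟨l - 1, by omega⟩) (s' ⟨l - 1, by omega⟩) (s 0) (s' 0)) ↔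
    ∀ z, onSquare s z = onSquare s' (mv.work z) := by
  have hl : 0 < l := Nat.pos_of_ne_zero (NeZero.ne l)
  -- The shift in one direction; exchanging the two tapes yields the other.
  have key : ∀ p p' : Fin l → ZMod k → X, ((∀ j (hj : j + 1 < l), ∀ r,
        p ⟨j, by omega⟩ r = p' ⟨j + 1, hj⟩ (r + 0)) ∧
      ∀ r, p ⟨l - 1, by omega⟩ r = p' 0 (r + 1)) ↔
      ∀ z, onSquare p z = onSquare p' (z + 1) := by
    intro p p'
    constructor
    · rintro ⟨h₁, h₂⟩ z
      rcases cellIdx_add_one (l := l) z with ⟨h, hi, hd⟩ | ⟨h, hi, hd⟩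
      · rw [onSquare, onSquare, hi, hd]
        simpa using h₁ _ h ((z / l : ℤ) : ZMod k)
      · rw [onSquare, onSquare, hi, hd, show cellIdx l z = ⟨l - 1, by omega⟩ from Fin.ext h]
        simpa using h₂ ((z / l : ℤ) : ZMod k)
    · intro h
      refine ⟨fun j hj r => ?_, fun r => ?_⟩
      · have := h (square (⟨j, by omega⟩ : Fin l) r)
        rw [onSquare_square] at this
        rw [this]
        rcases cellIdx_add_one (l := l) (square (⟨j, by omega⟩ : Fin l) r) with ⟨h, hi, hd⟩ | ⟨h, hi, hd⟩
        · rw [onSquare, hi, hd, square_ediv]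
          simp [cellIdx_square]
        · rw [cellIdx_square] at h
          simp only at h
          omega
      · have := h (square (⟨l - 1, by omega⟩ : Fin l) r)
        rw [onSquare_square] at this
        rw [this]
        rcases cellIdx_add_one (l := l) (square (⟨l - 1, by omega⟩ : Fin l) r) with
          ⟨h, hi, hd⟩ | ⟨h, hi, hd⟩
        · rw [cellIdx_square] at h
          simp only at h
          omega
        · rw [onSquare, hi, hd, Int.cast_add, square_ediv]
          simp
  cases mv with
  | right =>
    simp only [Shifts, Move.work, ← key]
    exact and_congr_right fun _ => ⟨fun h => h hl, fun h _ => h⟩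
  | left =>
    have : (∀ z, onSquare s z = onSquare s' (z - 1)) ↔ ∀ z, onSquare s' z = onSquare s (z + 1) :=
      ⟨fun h z => by rw [h, add_sub_cancel_right], fun h z => by rw [h, sub_add_cancel]⟩
    simp only [Shifts, Move.work]
    rw [this, ← key]
    constructor
    · rintro ⟨h₁, h₂⟩
      exact ⟨fun j hj r => (h₁ j hj r).symm, fun r => (h₂ hl r).symm⟩
    · rintro ⟨h₁, h₂⟩
      exact ⟨fun j hj r => (h₁ j hj r).symm, fun _ r => (h₂ r).symm⟩
  | stay =>
    simp only [Shifts, Move.work]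
    constructor
    · rintro ⟨h₁, h₂⟩ z
      rcases cellIdx_add_one (l := l) z with ⟨h, -⟩ | ⟨h, -⟩
      · exact h₁ _ h _
      · rw [onSquare, onSquare, show cellIdx l z = ⟨l - 1, by omega⟩ from Fin.ext h]
        exact h₂ hl _
    · intro h
      have h' : ∀ j r, s j r = s' j r := fun j r => by
        simpa [onSquare_square] using h (square j r)
      exact ⟨fun _ _ _ => h' _ _, fun _ _ => h' _ _⟩

/-- Every shift of a circular tape is a circular tape. -/
theorem exists_onSquare_eq [NeZero k] (s : Fin l → ZMod k → X) (mv : Move) :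
    ∃ s' : Fin l → ZMod k → X, ∀ z, onSquare s' z = onSquare s (mv.work z) := by
  refine ⟨fun j r => onSquare s (mv.work (square j r)), fun z => ?_⟩
  obtain ⟨t, ht⟩ := exists_square_eq (k := k) (l := l) z
  rw [onSquare, ht, ← onSquare_add_mul s (mv.work z) t]
  congr 1
  cases mv <;> simp [Move.work] <;> ring

end Circular

end LogSpace

/-! ### Movements of the input head. -/

namespace LogSpace

instance finite_move : Finite Move :=
  Finite.of_injective
    (fun m : Move => match m with | .left => (0 : Fin 3) | .stay => 1 | .right => 2)
    (by rintro (_ | _ | _) (_ | _ | _) h <;> simp_all)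

namespace Machine

instance {α β : Type} (M : Machine α β) : Finite M.Q := M.finQ
instance {α β : Type} (M : Machine α β) : Finite M.Γ := M.finΓ
instance {α β : Type} (M : Machine α β) : Finite M.Tapes := M.finTapes

end Machine

/-- The effective movement of the input head that reads `s`. -/
def effMove {α : Type} : InSym α → Move → Move
  | .leftEnd, .left => .stay
  | .rightEnd, .right => .stay
  | _, m => m

/-- The head position changes from `p` to `p'`. -/
def Moved (p p' : ℕ) : Move → Prop
  | .left => p' + 1 = p
  | .stay => p = p'
  | .right => p + 1 = p'

/-- The head is clamped only at the end markers, and these are visible as the letter read; replacing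
the blocked moves by `stay` makes the movement an exact change by at most one. -/
theorem input_eq_iff {α : Type} {x : List α} {p p' : ℕ} (hp : p ≤ x.length + 1) (m : Move) :
    p' = m.input x.length p ↔ Moved p p' (effMove (readInput x p) m) := by
  rcases p with _ | p
  · cases m <;> simp [readInput, effMove, Moved, Move.input, eq_comm]
  · rcases Nat.lt_or_ge p x.length with h | h
    · have : readInput x (p + 1) = .letter x[p] := by simp [readInput, h]
      rw [this]
      cases m <;> simp [effMove, Moved, Move.input] <;> omega
    · obtain rfl : p = x.length := by omega
      rw [Enumerator.readInput_length_succ]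
      cases m <;> simp [effMove, Moved, Move.input] <;> omega

/-! ### The graph of timed configurations. -/

namespace ConfigGraph

variable {α : Type} (M : Machine α Empty) (k : ℕ)

/-- The part of the work tapes that is stored in one cell. -/
abbrev Slots : Type := M.Tapes → ZMod k → M.Γ

/-- A configuration is stored in cells which contain the state (only the one in the first cell
matters), a binary digit of the position of the input head, and a part of the work tapes, whose
squares are numbered relative to the heads. -/
abbrev ConfCell : Type := M.Q × Bool × Slots M k

/-- The base in which time is measured. -/
noncomputable def base : ℕ := Nat.card (ConfCell M k)

/-- The cells of the nodes of the graph: a configuration and a digit of the time. -/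
abbrev NodeCell : Type := ConfCell M k × Fin (base M k)

/-- The cells of the witnesses for the edges of the graph. -/
structure EdgeCell : Type where
  state : M.Q
  src : Slots M k
  time : Fin (base M k)
  tgt : NodeCell M k
  mid : Slots M k
  back : Bool
  move : M.Tapes → Move
  dir : Move
  carry : Bool
  tick : Bool

variable {M k}

/-- The source cell; the digit of the position is not part of the witness. -/
def srcCell (c : Bool × EdgeCell M k) : NodeCell M k := ((c.2.state, c.1, c.2.src), c.2.time)

/-- The target cell. -/
def tgtCell (c : Bool × EdgeCell M k) : NodeCell M k := c.2.tgt

/-- The digit of the smaller one of the two positions of the input head. -/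
def lowBit (dir : Move) (c : Bool × EdgeCell M k) : ℕ :=
  match dir with
  | .left => c.2.tgt.1.2.1.toNat
  | _ => c.1.toNat

/-- The digit of the larger one of the two positions of the input head. -/
def highBit (dir : Move) (c : Bool × EdgeCell M k) : ℕ :=
  match dir with
  | .left => c.1.toNat
  | _ => c.2.tgt.1.2.1.toNat

/-- The difference of the two positions. -/
def moveBit : Move → Bool
  | .stay => false
  | _ => true

variable {l : ℕ}

/-- The position of the input head. -/
def pos (y : Fin (l + 1) → ConfCell M k) : ℕ := value 2 fun j => (y j).2.1.toNat

/-- The contents of a work tape, relative to the head. -/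
def track (y : Fin (l + 1) → ConfCell M k) (i : M.Tapes) : Fin (l + 1) → ZMod k → M.Γ :=
  fun j => (y j).2.2 i

/-- `y'` is the configuration after the action `a` in the configuration `y`. -/
def StepVia (x : List α) (a : Action Empty M.Q M.Γ M.Tapes) (y y' : Fin (l + 1) → ConfCell M k) :
    Prop :=
  (y' 0).1 = a.next ∧ pos y' = a.moveInput.input x.length (pos y) ∧
    ∀ i z, onSquare (track y' i) z =
      onSquare (overwrite (track y i) (a.write i)) ((a.moveWork i).work z)

/-- `y'` is a successor configuration of `y`. -/
def ConfStep (x : List α) (y y' : Fin (l + 1) → ConfCell M k) : Prop :=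
  ∃ a ∈ M.trans (y 0).1 (readInput x (pos y)) (fun i => (y 0).2.2 i 0), StepVia x a y y'

/-- The configuration part of a node. -/
def conf (v : Fin (l + 1) → NodeCell M k) : Fin (l + 1) → ConfCell M k := fun j => (v j).1

/-- The time of a node. -/
noncomputable def time (v : Fin (l + 1) → NodeCell M k) : ℕ := value (base M k) fun j => (v j).2

/-- Sorting the two positions by the direction turns moves to either side into the addition of `0`
or `1`, entered as the initial carry. -/
theorem value_lowBit_add (dir : Move) (u : Fin (l + 1) → Bool × EdgeCell M k) :
    (value 2 fun j => lowBit dir (u j)) + (moveBit dir).toNat =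
        (value 2 fun j => highBit dir (u j)) ↔
      Moved (value 2 fun j => (u j).1.toNat) (value 2 fun j => (u j).2.tgt.1.2.1.toNat) dir := by
  cases dir <;> simp [lowBit, highBit, moveBit, Moved]

/-- The position digits of the source come from the enumerator rather than from the witness, so they
have to be recovered from the number that they denote. -/
theorem srcCell_testBit_pos (v : Fin (l + 1) → NodeCell M k) (w : Fin (l + 1) → EdgeCell M k)
    (h₁ : ∀ j, (w j).state = (v j).1.1) (h₂ : ∀ j, (w j).src = (v j).1.2.2)
    (h₃ : ∀ j, (w j).time = (v j).2) :
    v = fun j : Fin (l + 1) => srcCell ((pos (conf v)).testBit j, w j) := by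
  funext j
  have : (pos (conf v)).testBit j = (v j).1.2.1 := testBit_value _ j
  simp only [srcCell, this, h₁, h₂, h₃]

/-- The word `y` represents the configuration `c`, as far as the squares at distance at most `S`
from the origin are concerned. -/
def Rep (x : List α) (S : ℕ) (y : Fin (l + 1) → ConfCell M k) (c : M.Cfg) : Prop :=
  (y 0).1 = c.state ∧ pos y = c.inputHead ∧ c.inputHead ≤ x.length + 1 ∧
    ∀ i (p : ℤ), |p| ≤ S → onSquare (track y i) (p - c.head i) = c.tape i p

variable {x : List α} {S : ℕ} {y y' : Fin (l + 1) → ConfCell M k} {c c' : M.Cfg}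

theorem input_le (m : Move) {n p : ℕ} (h : p ≤ n + 1) : m.input n p ≤ n + 1 := by
  cases m <;> simp [Move.input] <;> omega

theorem Rep.trans_eq (h : Rep x S y c) (hc : ∀ i, |c.head i| ≤ (S : ℤ)) :
    M.trans (y 0).1 (readInput x (pos y)) (fun i => (y 0).2.2 i 0) =
      M.trans c.state (readInput x c.inputHead) (fun i => c.tape i (c.head i)) := by
  obtain ⟨h₁, h₂, -, h₄⟩ := h
  rw [h₁, h₂]
  congr 1
  funext i
  rw [← h₄ i _ (hc i), sub_self]
  simp [onSquare, (cellIdx_eq_zero_iff (l := l + 1) 0).2 (dvd_zero _), track]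

theorem Rep.apply (hS : 2 * S < (l + 1) * k) (h : Rep x S y c)
    (hc : ∀ i, |c.head i| ≤ (S : ℤ)) {a : Action Empty M.Q M.Γ M.Tapes} (ha : StepVia x a y y') :
    Rep x S y' (c.apply x.length a) := by
  obtain ⟨h₁, h₂, h₃, h₄⟩ := h
  obtain ⟨ha₁, ha₂, ha₃⟩ := ha
  refine ⟨ha₁, by rw [ha₂, h₂]; rfl, input_le _ h₃, fun i p hp => ?_⟩
  have hw : (a.moveWork i).work (p - (a.moveWork i).work (c.head i)) = p - c.head i := by
    cases a.moveWork i <;> simp [Move.work] <;> ring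
  -- Both squares are within `S` of the origin, so their distance is at most `2 * S`, less than the
  -- circumference; hence the written square collides with no other represented one.
  have hd : (((l + 1 : ℕ) : ℤ) * k ∣ p - c.head i) ↔ p = c.head i := by
    constructor
    · intro hd
      have hc := abs_le.1 (hc i)
      have hp := abs_le.1 hp
      have hS' : (2 * S : ℤ) < ((l + 1 : ℕ) : ℤ) * k := by exact_mod_cast hS
      have := Int.eq_zero_of_abs_lt_dvd hd (by rw [abs_lt]; constructor <;> linarith)
      linarith
    · rintro rfl
      simp
  simp only [Machine.Cfg.apply]
  rw [ha₃, hw, onSquare_overwrite, h₄ i p hp]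
  by_cases hpc : p = c.head i
  · rw [if_pos (hd.2 hpc), hpc, Function.update_self]
  · rw [if_neg (fun h => hpc (hd.1 h)), Function.update_of_ne hpc]

theorem Rep.exists_step (hS : 2 * S < (l + 1) * k) (h : Rep x S y c)
    (hc : ∀ i, |c.head i| ≤ (S : ℤ)) (hy : ConfStep x y y') :
    ∃ c', M.Step x c c' ∧ Rep x S y' c' := by
  obtain ⟨a, ha, hy⟩ := hy
  rw [h.trans_eq hc] at ha
  exact ⟨_, ⟨a, ha, rfl⟩, h.apply hS hc hy⟩

variable (M k) [NeZero k]

instance : Finite (EdgeCell M k) :=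
  Finite.of_injective
    (fun c : EdgeCell M k => ((c.state, c.src, c.time, c.tgt, c.mid), (c.back, c.move, c.dir,
      c.carry, c.tick)))
    (by rintro ⟨⟩ ⟨⟩ h; simp_all)

theorem base_pos : 0 < base M k :=
  have : Nonempty (ConfCell M k) := ⟨(M.start, false, fun _ _ => M.blank)⟩
  Nat.card_pos

/-- The cells of the initial node. -/
noncomputable def initCell : NodeCell M k :=
  ((M.start, false, fun _ _ => M.blank), ⟨0, base_pos M k⟩)

instance : Nonempty (EdgeCell M k) :=
  ⟨⟨M.start, fun _ _ => M.blank, (initCell M k).2, initCell M k, fun _ _ => M.blank, false,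
    fun _ => .stay, .stay, false, false⟩⟩

variable {M k}

variable (M k) in
/-- The witnesses for the edges: either the target is the initial node and the source is accepting,
or the edge is a step of the machine and time increases by one. -/
def tiling : Tiling α (Bool × EdgeCell M k) where
  first s f :=
    if f.2.back then f.2.state ∈ M.accept ∧ f.2.tgt = initCell M k
    else f.2.tick = true ∧ f.2.carry = moveBit f.2.dir ∧
      ∃ a ∈ M.trans f.2.state s (fun i => f.2.src i 0), f.2.tgt.1.1 = a.next ∧
        (∀ i r, f.2.mid i r = if r = 0 then a.write i else f.2.src i r) ∧
        f.2.move = a.moveWork ∧ f.2.dir = effMove s a.moveInput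
  adj f c c' :=
    if f.2.back then c'.2.tgt = initCell M k
    else c'.2.mid = c'.2.src ∧
      (∀ i, Shifts 0 (f.2.move i) (c.2.tgt.1.2.2 i) (c.2.mid i) (c'.2.tgt.1.2.2 i) (c'.2.mid i)) ∧
      lowBit f.2.dir c + c.2.carry.toNat = highBit f.2.dir c + 2 * c'.2.carry.toNat ∧
      (c.2.time : ℕ) + c.2.tick.toNat = c.2.tgt.2 + base M k * c'.2.tick.toNat
  last f c :=
    f.2.back ∨
      (∀ i, Shifts 1 (f.2.move i) (c.2.tgt.1.2.2 i) (c.2.mid i) (f.2.tgt.1.2.2 i) (f.2.mid i)) ∧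
      lowBit f.2.dir c + c.2.carry.toNat = highBit f.2.dir c ∧
      (c.2.time : ℕ) + c.2.tick.toNat = c.2.tgt.2

/-- The edges of the graph. -/
def Edge (x : List α) (v v' : Fin (l + 1) → NodeCell M k) : Prop :=
  ∃ i ≤ x.length + 1, ∃ w : Fin (l + 1) → EdgeCell M k,
    (tiling M k).Valid (readInput x i) (fun j : Fin (l + 1) => (i.testBit j, w j)) ∧
      v = (fun j : Fin (l + 1) => srcCell (i.testBit j, w j)) ∧
      v' = fun j : Fin (l + 1) => tgtCell (i.testBit j, w j)

/-- The local conditions are reassembled into global ones: `mid` is the tape after writing and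
before the shift, the shift holds on all squares, and both additions hold as a whole. -/
theorem valid_iff_of_not_back {s : InSym α} {u : Fin (l + 1) → Bool × EdgeCell M k}
    (hb : (u 0).2.back = false) : (tiling M k).Valid s u ↔
      (tiling M k).first s (u 0) ∧ (∀ j, j ≠ 0 → (u j).2.mid = (u j).2.src) ∧
      (∀ i z, onSquare (fun j => (u j).2.tgt.1.2.2 i) z =
        onSquare (fun j => (u j).2.mid i) (((u 0).2.move i).work z)) ∧
      Adds 2 (fun j => lowBit (u 0).2.dir (u j)) (fun j => highBit (u 0).2.dir (u j))
        (fun j => (u j).2.carry.toNat) ∧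
      Adds (base M k) (fun j => (u j).2.time) (fun j => (u j).2.tgt.2)
        (fun j => (u j).2.tick.toNat) := by
  have h0 : (u ⟨0, Nat.succ_pos l⟩).2.back = false := hb
  constructor
  · rintro ⟨h, hf, hadj, hlast⟩
    simp only [tiling, h0, Bool.false_eq_true, if_false, false_or] at hadj hlast
    refine ⟨hf, ?_, ?_, ⟨fun j hj => (hadj j hj).2.2.1, fun _ => hlast.2.1⟩,
      ⟨fun j hj => (hadj j hj).2.2.2, fun _ => hlast.2.2⟩⟩
    · rintro ⟨_ | j, hj⟩ hne
      · exact absurd rfl hne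
      · exact (hadj j hj).1
    · exact fun i => (shifts_iff _ _ _).1
        ⟨fun j hj => (hadj j hj).2.1 i, fun _ => hlast.1 i⟩
  · rintro ⟨hf, hmid, hshift, hpos, htime⟩
    have hshift := fun i => (shifts_iff (fun j => (u j).2.tgt.1.2.2 i) (fun j => (u j).2.mid i)
      ((u 0).2.move i)).2 (hshift i)
    refine ⟨Nat.succ_pos l, hf, fun j hj => ?_, ?_⟩
    · simp only [tiling, h0, Bool.false_eq_true, if_false]
      exact ⟨hmid _ (by simp [Fin.ext_iff]), fun i => (hshift i).1 j hj, hpos.1 j hj, htime.1 j hj⟩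
    · simp only [tiling, h0, Bool.false_eq_true, false_or]
      exact ⟨fun i => (hshift i).2 (Nat.succ_pos l), hpos.2 (Nat.succ_pos l),
        htime.2 (Nat.succ_pos l)⟩

/-- The bound `hl` ensures that the digits in the word denote exactly the position `i` whose input
letter was shown to the tiling. -/
theorem Edge.cases {x : List α} {v v' : Fin (l + 1) → NodeCell M k}
    (hl : x.length + 1 < 2 ^ (l + 1)) (h : Edge x v v') :
    ((v 0).1.1 ∈ M.accept ∧ v' = fun _ => initCell M k) ∨
      (ConfStep x (conf v) (conf v') ∧ time v' = time v + 1) := by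
  obtain ⟨i, hi, w, hv, rfl, rfl⟩ := h
  cases hb : (w 0).back with
  | true =>
    left
    obtain ⟨_, hf, hadj, -⟩ := hv
    have hb' : (w ⟨0, Nat.succ_pos l⟩).back = true := hb
    simp only [tiling, hb', if_true] at hf hadj
    refine ⟨hf.1, funext ?_⟩
    rintro ⟨_ | j, hj⟩
    · exact hf.2
    · exact hadj j hj
  | false =>
    right
    obtain ⟨hf, hmid, hshift, hpos, htime⟩ :=
      (valid_iff_of_not_back (u := fun j : Fin (l + 1) => (i.testBit j, w j)) hb).1 hv
    simp only [tiling, hb, Bool.false_eq_true, if_false] at hf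
    obtain ⟨htick, hcarry, a, ha, hnext, hm, hmove, hdir⟩ := hf
    have hposi : pos (conf fun j : Fin (l + 1) => srcCell (i.testBit j, w j)) = i :=
      value_testBit (lt_of_le_of_lt hi hl)
    have htime := htime.value_eq
    have hpos := hpos.value_eq
    simp only [hcarry] at hpos
    refine ⟨⟨a, ?_, hnext, ?_, fun t z => ?_⟩, ?_⟩
    · rw [hposi]
      exact ha
    · rw [hposi, input_eq_iff hi, ← hdir]
      have := (value_lowBit_add _ _).1 hpos
      rwa [show (value 2 fun j : Fin (l + 1) => (i.testBit j).toNat) = i from hposi] at this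
    · rw [← hmove]
      refine (hshift t z).trans (congrArg (fun s => onSquare s _) ?_)
      funext j r
      by_cases hj : j = 0
      · subst hj
        simp only [overwrite, true_and]
        exact hm t r
      · simp only [overwrite, hj, false_and, if_false]
        exact congrFun (congrFun (hmid j hj) t) r
    · simp only [htick, Bool.toNat_true] at htime
      exact htime.symm

theorem edge_of_accept {x : List α} {v : Fin (l + 1) → NodeCell M k}
    (hp : pos (conf v) ≤ x.length + 1) (hv : (v 0).1.1 ∈ M.accept) :
    Edge x v fun _ => initCell M k := by
  let w : Fin (l + 1) → EdgeCell M k := fun j =>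
    ⟨(v j).1.1, (v j).1.2.2, (v j).2, initCell M k, (v j).1.2.2, true, fun _ => .stay, .stay,
      false, false⟩
  refine ⟨pos (conf v), hp, w, ⟨Nat.succ_pos l, ?_, fun j hj => ?_, ?_⟩,
    srcCell_testBit_pos v w (fun _ => rfl) (fun _ => rfl) fun _ => rfl, rfl⟩
  · simp only [tiling, w, if_true, and_true]
    exact hv
  · simp [tiling, w]
  · simp [tiling, w]

theorem edge_of_confStep {x : List α} {v v' : Fin (l + 1) → NodeCell M k}
    (hp : pos (conf v) ≤ x.length + 1) (h : ConfStep x (conf v) (conf v'))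
    (ht : time v' = time v + 1) : Edge x v v' := by
  obtain ⟨a, ha, hnext, hpos, htrack⟩ := h
  set dir := effMove (readInput x (pos (conf v))) a.moveInput with hdir
  obtain ⟨tick, htick0, htick⟩ := exists_adds (b := base M k) (d := fun j => (v j).2)
    (d' := fun j => (v' j).2) (fun j => (v j).2.isLt) (fun j => (v' j).2.isLt) true ht.symm
  let w₀ : (Fin (l + 1) → Bool) → Fin (l + 1) → EdgeCell M k := fun κ j =>
    ⟨(v j).1.1, (v j).1.2.2, (v j).2, v' j,
      fun i => overwrite (track (conf v) i) (a.write i) j, false, a.moveWork, dir, κ j, tick j⟩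
  let u : (Fin (l + 1) → Bool) → Fin (l + 1) → Bool × EdgeCell M k := fun κ j =>
    ((pos (conf v)).testBit j, w₀ κ j)
  have hbit : ∀ j : Fin (l + 1), (pos (conf v)).testBit j = (v j).1.2.1 := testBit_value _
  have hlow : ∀ κ j, lowBit dir (u κ j) < 2 := fun κ j => by
    cases dir <;> exact Bool.toNat_lt _
  have hhigh : ∀ κ j, highBit dir (u κ j) < 2 := fun κ j => by
    cases dir <;> exact Bool.toNat_lt _
  -- The digits to be added do not depend on the carry field, so dummy carries serve until `κ` is
  -- found.
  obtain ⟨κ, hκ0, hκ⟩ := exists_adds (hlow fun _ => false) (hhigh fun _ => false) (moveBit dir)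
    ((value_lowBit_add dir (u fun _ => false)).2 (by
      have := (input_eq_iff hp _).1 hpos
      simp only [u, hbit]
      exact this))
  refine ⟨pos (conf v), hp, w₀ κ, ?_,
    srcCell_testBit_pos v (w₀ κ) (fun _ => rfl) (fun _ => rfl) fun _ => rfl, rfl⟩
  refine (valid_iff_of_not_back (u := u κ) rfl).2
    ⟨?_, fun j hj => ?_, fun i z => htrack i z, hκ, htick⟩
  · simp only [tiling, u, w₀, Bool.false_eq_true, if_false]
    exact ⟨htick0, hκ0, a, ha, hnext, fun i r => by simp [overwrite, track, conf], rfl, rfl⟩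
  · funext i r
    simp [u, w₀, overwrite, hj, track, conf]

/-- The new position still has `l + 1` binary digits and a shifted circular tape is circular, so
every action can be carried out on words. -/
theorem exists_stepVia (hl : x.length + 1 < 2 ^ (l + 1)) (y : Fin (l + 1) → ConfCell M k)
    (hp : pos y ≤ x.length + 1) (a : Action Empty M.Q M.Γ M.Tapes) :
    ∃ y' : Fin (l + 1) → ConfCell M k, StepVia x a y y' := by
  choose s hs using fun i =>
    exists_onSquare_eq (overwrite (track y i) (a.write i)) (a.moveWork i)
  refine ⟨fun j => (a.next, (a.moveInput.input x.length (pos y)).testBit j, fun i => s i j), rfl,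
    value_testBit (lt_of_le_of_lt (input_le _ hp) hl), fun i z => hs i z⟩

theorem rep_init : Rep x S (fun _ : Fin (l + 1) => (initCell M k).1) M.init :=
  ⟨rfl, by simp [pos, initCell, value, Machine.init], by simp [Machine.init], fun _ _ _ => rfl⟩

theorem Rep.exists_confStep (hl : x.length + 1 < 2 ^ (l + 1)) (hS : 2 * S < (l + 1) * k)
    (h : Rep x S y c) (hc : ∀ i, |c.head i| ≤ (S : ℤ)) (hstep : M.Step x c c') :
    ∃ y', ConfStep x y y' ∧ Rep x S y' c' := by
  obtain ⟨a, ha, rfl⟩ := hstep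
  rw [← h.trans_eq hc] at ha
  obtain ⟨y', hy'⟩ := exists_stepVia (k := k) hl y (h.2.1.trans_le h.2.2.1) a
  exact ⟨y', ⟨a, ha, hy'⟩, h.apply hS hc hy'⟩

/-! ### Acceptance and cycles. -/

/-- If every node of a nonempty set has a successor in the set, then the machine accepts. -/
theorem accepts_of_forall_exists_edge (hl : x.length + 1 < 2 ^ (l + 1))
    (hS : 2 * S < (l + 1) * k) (hM : ∀ c, M.Reaches x c → ∀ i, |c.head i| ≤ (S : ℤ))
    {X : Set (Fin (l + 1) → NodeCell M k)} (hne : X.Nonempty)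
    (hX : ∀ v ∈ X, ∃ v' ∈ X, Edge x v v') : M.Accepts x := by
  have htime : ∀ v : Fin (l + 1) → NodeCell M k, time v < base M k ^ (l + 1) := fun v => by
    have := (finFunctionFinEquiv fun j => (v j).2).isLt
    rwa [finFunctionFinEquiv_apply] at this
  -- Here `n` bounds the time left on the clock. A machine step consumes one unit, so a back edge to
  -- the initial node cannot be avoided.
  have hinit : ∀ n, ∀ v ∈ X, base M k ^ (l + 1) ≤ time v + n → (fun _ => initCell M k) ∈ X := by
    intro n
    induction n with
    | zero => exact fun v _ h => absurd (htime v) (by omega)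
    | succ n ih =>
      intro v hv h
      obtain ⟨v', hv', hE⟩ := hX v hv
      rcases hE.cases hl with ⟨-, rfl⟩ | ⟨-, ht⟩
      · exact hv'
      · exact ih v' hv' (by omega)
  -- The same descent, now with a reachable configuration represented by the node; the back edge
  -- that ends it leaves an accepting one.
  have hacc : ∀ n, ∀ v ∈ X, base M k ^ (l + 1) ≤ time v + n → ∀ c, M.Reaches x c →
      Rep x S (conf v) c → M.Accepts x := by
    intro n
    induction n with
    | zero => exact fun v _ h => absurd (htime v) (by omega)
    | succ n ih =>
      intro v hv h c hc hrep
      obtain ⟨v', hv', hE⟩ := hX v hv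
      rcases hE.cases hl with ⟨ha, -⟩ | ⟨hstep, ht⟩
      · exact ⟨c, hc, hrep.1 ▸ ha⟩
      · obtain ⟨c', hcc', hrep'⟩ := hrep.exists_step hS (hM c hc) hstep
        exact ih v' hv' (by omega) c' (hc.tail hcc') hrep'
  obtain ⟨v, hv⟩ := hne
  exact hacc _ _ (hinit _ v hv (Nat.le_add_left _ _)) (Nat.le_add_left _ _) _ .refl rep_init

/-- If the machine accepts, then the graph has a cycle. -/
theorem exists_cycle_of_accepts (hl : x.length + 1 < 2 ^ (l + 1))
    (hS : 2 * S < (l + 1) * k) (hM : ∀ c, M.Reaches x c → ∀ i, |c.head i| ≤ (S : ℤ))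
    (h : M.Accepts x) : ∃ X : Set (Fin (l + 1) → NodeCell M k), X.Nonempty ∧
      ∀ v ∈ X, ∃ v' ∈ X, Edge x v v' := by
  classical
  have := Fintype.ofFinite (ConfCell M k)
  obtain ⟨c, hc, hcacc⟩ := h
  obtain ⟨y, hy, hrep⟩ : ∃ y : Fin (l + 1) → ConfCell M k, Relation.ReflTransGen (ConfStep x)
      (fun _ : Fin (l + 1) => (initCell M k).1) y ∧ Rep x S y c := by
    clear hcacc
    induction hc with
    | refl => exact ⟨_, .refl, rep_init⟩
    | tail hc hcc' ih =>
      obtain ⟨y, hy, hrep⟩ := ih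
      obtain ⟨y', hyy', hrep'⟩ := hrep.exists_confStep hl hS (hM _ hc) hcc'
      exact ⟨y', hy.tail hyy', hrep'⟩
  -- There are `base M k ^ (l + 1)` configuration words, so the indices along a shortest path are
  -- possible clock values. This is the reason for the choice of `base`.
  obtain ⟨n, hn, p, hp0, hpn, hp⟩ := exists_path_lt_card hy
  rw [Fintype.card_fun, Fintype.card_fin, ← Nat.card_eq_fintype_card] at hn
  change n < base M k ^ (l + 1) at hn
  have hpos : ∀ j ≤ n, pos (p j) ≤ x.length + 1 := by
    intro j
    induction j with
    | zero =>
      intro _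
      rw [hp0]
      simp [pos, initCell, value]
    | succ j ih =>
      intro hj
      obtain ⟨a, -, -, ha, -⟩ := hp j hj
      rw [ha]
      exact input_le _ (ih (by omega))
  obtain ⟨dig, hdig⟩ : ∃ dig : ℕ → Fin (l + 1) → Fin (base M k), ∀ j ≤ n,
      (value (base M k) fun i => (dig j i : ℕ)) = j := by
    refine ⟨fun j => if h : j < base M k ^ (l + 1) then finFunctionFinEquiv.symm ⟨j, h⟩ else
      fun _ => (initCell M k).2, fun j hj => ?_⟩
    have hj : j < base M k ^ (l + 1) := by omega
    simp only [hj, dif_pos]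
    rw [value, ← finFunctionFinEquiv_apply, Equiv.apply_symm_apply]
  let v : ℕ → Fin (l + 1) → NodeCell M k := fun j i => (p j i, dig j i)
  have hv0 : v 0 = fun _ => initCell M k := by
    funext i
    refine Prod.ext (congrFun hp0 i) (Fin.ext ?_)
    -- A sum of naturals that is zero has zero terms, so clock value zero has only zero digits and
    -- `v 0` is literally the initial word.
    have h₀ := hdig 0 (Nat.zero_le _)
    rw [value, Finset.sum_eq_zero_iff] at h₀
    have := h₀ i (Finset.mem_univ i)
    have hb := base_pos M k
    rcases mul_eq_zero.1 this with h | h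
    · exact h
    · exact absurd h (pow_pos hb _).ne'
  refine ⟨{u | ∃ j ≤ n, u = v j}, ⟨v 0, 0, Nat.zero_le _, rfl⟩, ?_⟩
  rintro _ ⟨j, hj, rfl⟩
  rcases Nat.lt_or_ge j n with hjn | hjn
  · refine ⟨v (j + 1), ⟨j + 1, hjn, rfl⟩, edge_of_confStep (hpos j hj) (hp j hjn) ?_⟩
    change (value _ _) = (value _ _) + 1
    rw [hdig (j + 1) hjn, hdig j hj]
  · obtain rfl : j = n := le_antisymm hj hjn
    refine ⟨v 0, ⟨0, Nat.zero_le _, rfl⟩, ?_⟩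
    rw [hv0]
    refine edge_of_accept (hpos j hj) ?_
    change (p j 0).1 ∈ _
    rw [hpn, hrep.1]
    exact hcacc

end ConfigGraph

/-! ### The reduction. -/

open ConfigGraph in
/-- The IGA-entailment of the query `edgeQuery` is NL-hard. -/
theorem nlHard_igaEnt : NLHard (CQE.IGAEnt ∅ {CQE.succED} CQE.edgeQuery) := by
  classical
  intro α _ L ⟨M, ⟨K, hK⟩, hL⟩
  -- With `2 * K + 1` slots per cell, the circumference exceeds twice the space bound `K * (log n +
  -- 1)`.
  have := Fintype.ofFinite (NodeCell M (2 * K + 1))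
  obtain ⟨f, hf, hspec⟩ := exists_logSpaceComputable_edges (tiling M (2 * K + 1)) srcCell tgtCell
  refine ⟨f, hf, fun x => ?_⟩
  rw [hL]
  obtain ⟨F, hF, hmem⟩ := hspec x
  rw [hF, CQE.flatMap_encodeFact_mem_igaEnt]
  have hlen : x.length + 1 < 2 ^ Enumerator.len x := Nat.lt_size_self _
  have hlog : Nat.log 2 x.length + 1 ≤ Enumerator.len x := by
    rw [Nat.succ_le_iff, Enumerator.len, Nat.lt_size]
    rcases Nat.eq_zero_or_pos x.length with h | h
    · simp [h]
    · exact (Nat.pow_log_le_self 2 h.ne').trans (Nat.le_succ _)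
  generalize Enumerator.len x = l at hmem hlen hlog
  obtain ⟨l, rfl⟩ : ∃ l', l = l' + 1 := ⟨l - 1, by omega⟩
  have hS : 2 * (K * (Nat.log 2 x.length + 1)) < (l + 1) * (2 * K + 1) := by
    have := Nat.mul_le_mul_left (2 * K) hlog
    have e : (l + 1) * (2 * K + 1) = 2 * K * (l + 1) + (l + 1) := by ring
    rw [e, ← mul_assoc]
    omega
  have hmem : ∀ a, a ∈ F ↔ ∃ v v' : Fin (l + 1) → NodeCell M (2 * K + 1), Edge x v v' ∧
      a = CQE.edge (wordName v) (wordName v') := by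
    intro a
    rw [hmem]
    constructor
    · rintro ⟨i, hi, w, hw, rfl⟩
      exact ⟨_, _, ⟨i, hi, w, hw, rfl, rfl⟩, rfl⟩
    · rintro ⟨v, v', ⟨i, hi, w, hw, rfl, rfl⟩, rfl⟩
      exact ⟨i, hi, w, hw, rfl⟩
  constructor
  · intro h
    obtain ⟨X, ⟨v₀, hv₀⟩, hX⟩ := exists_cycle_of_accepts hlen hS (hK x) h
    choose! next hnext hedge using hX
    refine ⟨{a | ∃ v ∈ X, a = CQE.edge (wordName v) (wordName (next v))}, ?_, ?_, ?_⟩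
    · rintro _ ⟨v, hv, rfl⟩
      exact (hmem _).2 ⟨v, next v, hedge v hv, rfl⟩
    · exact ⟨_, _, v₀, hv₀, rfl⟩
    · rintro a b ⟨v, hv, hab⟩
      obtain ⟨-, -, rfl⟩ := CQE.Atom.role.inj hab
      exact ⟨_, next v, hnext v hv, rfl⟩
  · rintro ⟨C, hC, ⟨a, b, hab⟩, hsucc⟩
    -- The nodes with an outgoing edge in `C` have successors of the same kind, because `C` has no
    -- dead ends and names determine nodes.
    refine accepts_of_forall_exists_edge hlen hS (hK x)
      (X := {v | ∃ b, CQE.edge (wordName v) b ∈ C}) ?_ ?_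
    · obtain ⟨v, v', -, e⟩ := (hmem _).1 (hC _ hab)
      obtain ⟨-, rfl, -⟩ := CQE.Atom.role.inj e
      exact ⟨v, b, hab⟩
    · rintro v ⟨b, hb⟩
      obtain ⟨u, v', hE, e⟩ := (hmem _).1 (hC _ hb)
      obtain ⟨-, hu, rfl⟩ := CQE.Atom.role.inj e
      obtain rfl := wordName_injective hu
      exact ⟨v', hsucc _ _ hb, hE⟩

end LogSpace

/-- There are a policy consisting of one linear ED and a Boolean query consisting of one atom for
which IGA-entailment with the empty TBox is NL-hard in data complexity. -/
theorem mainTheorem2 :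
    ∃ (P : CQE.Policy) (q : CQE.BUCQ),
      P.card = 1 ∧ P.IsLinear ∧ q.IsSingleAtom ∧
        LogSpace.NLHard (CQE.IGAEnt ∅ P q) := by
  refine ⟨{CQE.succED}, CQE.edgeQuery, Finset.card_singleton _, fun τ hτ => ?_,
    ⟨_, rfl, Finset.card_singleton _⟩, LogSpace.nlHard_igaEnt⟩
  rw [Finset.mem_singleton.1 hτ]
  exact Finset.card_singleton _
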